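/- Let $F(x)=\frac1n\sum_{i=1}^n f_i(x)$ on $\mathbb R^d$, where $n>10$, each $f_i$ is twice continuously differentiable, $\|\nabla f_i(x)-\nabla f_i(y)\|_2\le L_1\|x-y\|_2$ and $\|\nabla^2 f_i(x)-\nabla^2 f_i(y)\|_2\le L_2\|x-y\|_2$ for all $i,x,y$ (with $L_1,L_2>0$), and $F$ is bounded below; put $\Delta_F=F(\hat x^0)-\inf F$. For penalty parameter $M>0$ put $$\mu(x)=\max\{\|\nabla F(x)\|_2^{3/2},\,-(\lambda_{\min}(\nabla^2F(x)))^3M^{-3/2}\}.$$ A point $x$ is an $(\epsilon_g,\epsilon_H)$-approximate local minimum if $\|\nabla F(x)\|_2\le\epsilon_g$ and $\lambda_{\min}(\nabla^2F(x))\ge-\epsilon_H$. Lite-SVRC, started at $\hat x^0$, runs epochs $s=1,\dots,S$. Epoch $s$ sets $x_0^s=\hat x^{s-1}$, computes the full gradient $g^s=\nabla F(\hat x^{s-1})$ and Hessian $H^s=\nabla^2F(\hat x^{s-1})$, and sets $v_0^s=g^s$, $U_0^s=H^s$. For $t=1,\dots,T-1$ it draws index batches $I_g,I_h$ uniformly with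 replacement from $\{1,\dots,n\}$, independently of each other and of the past, of sizes $\lceil D_g/\|x_t^s-\hat x^{s-1}\|_2^2\rceil$ and $\lceil D_h\rceil$ (if $x_t^s=\hat x^{s-1}$, the gradient correction is zero), and sets $$v_t^s=\tfrac1{|I_g|}\sum_{i\in I_g}[\nabla f_i(x_t^s)-\nabla f_i(\hat x^{s-1})]+g^s,\qquad U_t^s=\tfrac1{|I_h|}\sum_{j\in I_h}[\nabla^2 f_j(x_t^s)-\nabla^2 f_j(\hat x^{s-1})]+H^s.$$ For $t=0,\dots,T-1$, $x_{t+1}^s=x_t^s+h_t^s$, where $h_t^s$ is a global minimizer of $h\mapsto\langle v_t^s,h\rangle+\frac12\langle U_t^sh,h\rangle+\frac M6\|h\|_2^3$; then $\hat x^s=x_T^s$. The output $x_{\rm out}$ is chosen uniformly at random from $\{x_t^s:1\le s\le S,\ 1\le t\le T\}$. For every absolute constant $C_h>0$ and every sufficiently large absolute constant $C_m>2$ (how large depends only on $C_h$), there are constants $C_s,K>0$ depending only on $C_h,C_m$ such that the following holds. Take $D_g=\frac{4L_1^2}{L_2^2}n^{4/3}$, $D_h=\log d\cdot(C_hn)^{2/3}$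 with $D_h>25\log d$ (in particular $d\ge2$), $M=C_mL_2$, $T=n^{1/3}$ rounded up or down to an integer, $\epsilon>0$, and $S=\big\lfloor C_s\sqrt{L_2}\,\Delta_F/(\epsilon^{3/2}n^{1/3})\big\rfloor+1$. Then $x_{\rm out}$ is an $(\epsilon,\sqrt{L_2\epsilon})$-approximate local minimum in the expected-$\mu$ sense: $$\mathbb E\,\mu(x_{\rm out})\le(\epsilon/C_m)^{3/2},$$ where every $x$ with $\mu(x)\le(\epsilon/C_m)^{3/2}$ is an $(\epsilon,\sqrt{L_2\epsilon})$-approximate local minimum; and the run always makes at most $$K\log d\cdot\Big(n+\frac{\Delta_F\sqrt{L_2}}{\epsilon^{3/2}}\,n^{2/3}\Big)=\tilde O\Big(n+\frac{\Delta_F\sqrt{L_2}}{\epsilon^{3/2}}\,n^{2/3}\Big)$$ evaluations of component Hessians $\nabla^2f_i(x)$. -/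

import Mathlib

open scoped ENNReal

noncomputable section

namespace LiteSVRC

/-- The Euclidean space `ℝ^d`. -/
abbrev Vec (d : ℕ) : Type := EuclideanSpace ℝ (Fin d)

/-- Linear operators on `ℝ^d` (matrices), with the operator norm, i.e. the spectral norm. -/
abbrev Op (d : ℕ) : Type := Vec d →L[ℝ] Vec d

/-- The Hessian of `g` at `x`: the derivative of the gradient field of `g`. -/
def hess {d : ℕ} (g : Vec d → ℝ) (x : Vec d) : Op d := fderiv ℝ (gradient g) x

/-- The smallest eigenvalue of an operator (a minimum for symmetric operators, `d ≥ 1`). -/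
def lambdaMin {d : ℕ} (A : Op d) : ℝ :=
  sInf {l : ℝ | Module.End.HasEigenvalue (A : Vec d →ₗ[ℝ] Vec d) l}

/-- `F = (1/n) ∑ f_i`. -/
def objective {d n : ℕ} (f : Fin n → Vec d → ℝ) (x : Vec d) : ℝ := (1 / (n : ℝ)) * ∑ i, f i x

/-- `Δ_F = F(x₀) - inf F`. -/
def gap {d n : ℕ} (f : Fin n → Vec d → ℝ) (x₀ : Vec d) : ℝ :=
  objective f x₀ - ⨅ x, objective f x

/-- `x` is an `(εg, εH)`-approximate local minimum of `F`. -/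
def IsApproxLocalMin {d : ℕ} (F : Vec d → ℝ) (εg εH : ℝ) (x : Vec d) : Prop :=
  ‖gradient F x‖ ≤ εg ∧ -εH ≤ lambdaMin (hess F x)

/-- `μ(x) = max {‖∇F(x)‖^{3/2}, -(λ_min(∇²F(x)))³ M^{-3/2}}`. -/
def mu {d : ℕ} (F : Vec d → ℝ) (M : ℝ) (x : Vec d) : ℝ :=
  max (‖gradient F x‖ ^ (3 / 2 : ℝ)) (-(lambdaMin (hess F x)) ^ 3 * M ^ (-(3 / 2) : ℝ))

/-- The cubic-regularized model `⟨v, h⟩ + ½ ⟨U h, h⟩ + (M/6) ‖h‖³`. -/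
def cubicModel {d : ℕ} (M : ℝ) (v : Vec d) (U : Op d) (h : Vec d) : ℝ :=
  inner ℝ v h + (1 / 2) * inner ℝ (U h) h + M / 6 * ‖h‖ ^ 3

/-- `argm` solves the cubic subproblem exactly: for every `M > 0`, every `v` and every symmetric
`U`, `argm M v U` is a global minimizer of the cubic model. Minimizers need not be unique; `argm`
is an arbitrary choice of one. -/
def IsCubicArgmin {d : ℕ} (argm : ℝ → Vec d → Op d → Vec d) : Prop :=
  ∀ (M : ℝ) (v : Vec d) (U : Op d), 0 < M → (U : Vec d →ₗ[ℝ] Vec d).IsSymmetric →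
    ∀ h, cubicModel M v U (argm M v U) ≤ cubicModel M v U h

/-- The full gradient `(1/n) ∑ ∇f_i(x)`. -/
def fullGrad {d n : ℕ} (f : Fin n → Vec d → ℝ) (x : Vec d) : Vec d :=
  (1 / (n : ℝ)) • ∑ i, gradient (f i) x

/-- The full Hessian `(1/n) ∑ ∇²f_i(x)`, computed with `n` stochastic Hessian evaluations. -/
def fullHess {d n : ℕ} (f : Fin n → Vec d → ℝ) (x : Vec d) : Op d :=
  (1 / (n : ℝ)) • ∑ i, hess (f i) x

/-- The semi-stochastic gradient at `x`, with reference point `xr` and sampled indices `I`. -/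
def semiGrad {d n b : ℕ} (f : Fin n → Vec d → ℝ) (xr x : Vec d) (I : Fin b → Fin n) : Vec d :=
  (1 / (b : ℝ)) • (∑ k, (gradient (f (I k)) x - gradient (f (I k)) xr)) + fullGrad f xr

/-- The semi-stochastic Hessian at `x`, with reference point `xr` and sampled indices `I`. -/
def semiHess {d n B : ℕ} (f : Fin n → Vec d → ℝ) (xr x : Vec d) (I : Fin B → Fin n) : Op d :=
  (1 / (B : ℝ)) • (∑ k, (hess (f (I k)) x - hess (f (I k)) xr)) + fullHess f xr

/-- `b` independent uniform draws from the `n` indices (sampling with replacement). -/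
def sampleBatch (n b : ℕ) [NeZero n] : PMF (Fin b → Fin n) := PMF.uniformOfFintype _

/-- The state of a run. -/
structure RunState (d : ℕ) where
  /-- the current iterate -/
  pt : Vec d
  /-- all iterates `x_t^s`, `t ≥ 1`, produced so far, the latest first -/
  hist : List (Vec d)
  /-- the number of evaluations of a component Hessian `∇²f_i` made so far -/
  evals : ℕ

/-- Move from the current point by `h`, having used `k` component Hessian evaluations for it. -/
def RunState.move {d : ℕ} (st : RunState d) (h : Vec d) (k : ℕ) : RunState d :=
  ⟨st.pt + h, (st.pt + h) :: st.hist, st.evals + k⟩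

/-- One stochastic inner iteration (`t ≥ 1`) with reference point `xr` and penalty `M`. The batch
sizes are `D_g / ‖x - xr‖²` and `D_h`, rounded up. If `x = xr` the gradient batch is empty and the
semi-stochastic gradient is the full one, which is its value for any other batch as well.
Each sampled index costs two Hessian evaluations, one at `x` and one at `xr`. -/
def innerStep {d n : ℕ} [NeZero n] (f : Fin n → Vec d → ℝ) (argm : ℝ → Vec d → Op d → Vec d)
    (Dg Dh M : ℝ) (xr : Vec d) (st : RunState d) : PMF (RunState d) :=
  (sampleBatch n ⌈Dg / ‖st.pt - xr‖ ^ 2⌉₊).bind fun Ig =>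
    (sampleBatch n ⌈Dh⌉₊).bind fun Ih =>
      PMF.pure (st.move (argm M (semiGrad f xr st.pt Ig) (semiHess f xr st.pt Ih)) (2 * ⌈Dh⌉₊))

/-- The stochastic inner iterations `t = 1, …, k` of an epoch; `M t` is the penalty at `t`. -/
def innerLoop {d n : ℕ} [NeZero n] (f : Fin n → Vec d → ℝ) (argm : ℝ → Vec d → Op d → Vec d)
    (Dg Dh : ℝ) (M : ℕ → ℝ) (xr : Vec d) (st : RunState d) : ℕ → PMF (RunState d)
  | 0 => PMF.pure st
  | k + 1 => (innerLoop f argm Dg Dh M xr st k).bind (innerStep f argm Dg Dh (M (k + 1)) xr)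

/-- One epoch of length `T ≥ 1`, started at the reference point `st.pt`: an exact cubic step with
the full gradient and Hessian, then `T - 1` stochastic inner iterations. -/
def epoch {d n : ℕ} [NeZero n] (f : Fin n → Vec d → ℝ) (argm : ℝ → Vec d → Op d → Vec d)
    (Dg Dh : ℝ) (M : ℕ → ℝ) (T : ℕ) (st : RunState d) : PMF (RunState d) :=
  innerLoop f argm Dg Dh M st.pt
    (st.move (argm (M 0) (fullGrad f st.pt) (fullHess f st.pt)) n) (T - 1)

/-- The state after the epochs `s = 1, …, S`; `M s t` is the penalty parameter `M_{s,t}`. -/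
def epochs {d n : ℕ} [NeZero n] (f : Fin n → Vec d → ℝ) (argm : ℝ → Vec d → Op d → Vec d)
    (Dg Dh : ℝ) (M : ℕ → ℕ → ℝ) (T : ℕ) (x₀ : Vec d) : ℕ → PMF (RunState d)
  | 0 => PMF.pure ⟨x₀, [], 0⟩
  | s + 1 => (epochs f argm Dg Dh M T x₀ s).bind (epoch f argm Dg Dh (M (s + 1)) T)

/-- Choose one of the produced iterates uniformly at random; report it with the number of Hessian
evaluations. (The first branch, no iterates, does not occur when `S ≥ 1`.) -/
def chooseOutput {d : ℕ} (st : RunState d) : PMF (Vec d × ℕ) :=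
  if h : st.hist.length = 0 then PMF.pure (st.pt, st.evals)
  else
    haveI : NeZero st.hist.length := ⟨h⟩
    (PMF.uniformOfFintype (Fin st.hist.length)).map fun i => (st.hist.get i, st.evals)

/-- Lite-SVRC: the joint law of the output `x_out` and of the total number of component Hessian
evaluations made by the run. -/
def liteSVRC {d n : ℕ} [NeZero n] (f : Fin n → Vec d → ℝ) (argm : ℝ → Vec d → Op d → Vec d)
    (Dg Dh : ℝ) (M : ℕ → ℕ → ℝ) (S T : ℕ) (x₀ : Vec d) : PMF (Vec d × ℕ) :=
  (epochs f argm Dg Dh M T x₀ S).bind chooseOutput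

/-- The expectation of a nonnegative function `g` under `p`, as an extended real number. -/
def expect {α : Type*} (p : PMF α) (g : α → ℝ) : ℝ≥0∞ := ∑' a, p a * ENNReal.ofReal (g a)

end LiteSVRC

end

open LiteSVRC

noncomputable section

namespace LiteSVRC

/-! The proof is a Lyapunov argument in conditional expectation. Take a cubic step whose gradient
and Hessian errors are at most `M p²` and `M q`, and let `z` be the largest of the step length, `p`
and `q`. Optimality of the step bounds the new gradient by a multiple of `M z²` and the new negative
curvature by a multiple of `M z`. Hence `μ` at the new point is at most a multiple of `M^{3/2} z³`,
and the decrease of the cubic model pays for it, up to an error `M (8 p³ + 289 q³)`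
(`cubic_step_decrease`).

Variance reduction makes the third moments of `p` and `q` of order `r³ / n`, where `r` is the
distance to the reference point. For the gradient a second moment of a sum of independent draws
suffices. For the Hessian one needs the third moment of an operator norm at a cost of only `log d`.
It comes from trace moments of order about `2 log d`, bounded by redrawing one index at a time and
using that the old and new batches are exchangeable (`sum_trace_pow_succ_le`, `sum_norm_cube_le`).

An error of size `r³` is not small in itself, but `r` is made of the steps taken since the epoch
began. So `a_j r³` is added to the Lyapunov function, with `j` the number of steps left and `a_0 =
0`. By convexity of the cube, one step multiplies `r³` by `(1 + 1/T)²` and adds `(1 + T)² ‖h‖³`. The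
weights stay of order `M T / n`, so for `T ≈ n^{1/3}` the extra term is of order `M ‖h‖³` and is
paid for by the decrease in the step. Since `r = 0` at the start of an epoch and `a_0 = 0` at its
end, `F - inf F` plus the weighted sum of past `μ` does not increase in expectation over an epoch.
Averaging over the `S T` iterates gives the bound on `μ`. The Hessian count is the same for every
run. -/

theorem nonneg_of_cubic_nonneg {α β γ : ℝ}
    (H : ∀ t : ℝ, 0 < t → 0 ≤ α * t + β * t ^ 2 + γ * t ^ 3) : 0 ≤ α := by
  have hlim : Filter.Tendsto (fun t : ℝ => α + β * t + γ * t ^ 2) (nhdsWithin 0 (Set.Ioi 0))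
      (nhds (α + β * 0 + γ * 0 ^ 2)) :=
    Filter.Tendsto.mono_left (Continuous.tendsto (by fun_prop) 0) nhdsWithin_le_nhds
  have : 0 ≤ α + β * 0 + γ * 0 ^ 2 := by
    refine ge_of_tendsto hlim ?_
    filter_upwards [self_mem_nhdsWithin] with t ht
    have ht' : (0 : ℝ) < t := ht
    have h1 := H t ht'
    have h2 : α * t + β * t ^ 2 + γ * t ^ 3 = t * (α + β * t + γ * t ^ 2) := by ring
    rw [h2] at h1
    exact nonneg_of_mul_nonneg_right h1 ht'
  simpa using this

theorem cubicModel_add {d : ℕ} (M : ℝ) (v : Vec d) {U : Op d}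
    (hU : (U : Vec d →ₗ[ℝ] Vec d).IsSymmetric) (h w : Vec d) :
    cubicModel M v U (h + w) = inner ℝ v h + (1 / 2) * inner ℝ (U h) h + inner ℝ (v + U h) w
      + (1 / 2) * inner ℝ (U w) w + M / 6 * ‖h + w‖ ^ 3 := by
  have h1 : inner ℝ (U w) h = inner ℝ (U h) w := by
    rw [real_inner_comm]; exact (hU h w).symm
  simp only [cubicModel, map_add, inner_add_left, inner_add_right, h1]
  ring

/-! ### Optimality conditions for the cubic model. -/

section Minimizer

variable {d : ℕ} {M : ℝ} {v : Vec d} {U : Op d} {h : Vec d}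

theorem norm_residual_le_of_isMin (hM : 0 < M) (hU : (U : Vec d →ₗ[ℝ] Vec d).IsSymmetric)
    (hmin : ∀ w, cubicModel M v U h ≤ cubicModel M v U w) :
    ‖v + U h‖ ≤ M / 2 * ‖h‖ ^ 2 := by
  set g := v + U h with hg
  have key : 0 ≤ -‖g‖ ^ 2 + M / 2 * ‖h‖ ^ 2 * ‖g‖ := by
    -- First variation in the direction `-g`; only the coefficient of `t` matters, and `β`, `γ`
    -- collect the higher orders.
    refine nonneg_of_cubic_nonneg (β := (1 / 2) * inner ℝ (U g) g + M / 2 * ‖h‖ * ‖g‖ ^ 2)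
      (γ := M / 6 * ‖g‖ ^ 3) fun t ht => ?_
    have h1 := hmin (h + (-t) • g)
    rw [cubicModel_add M v hU, ← hg] at h1
    have h2 : ‖h + (-t) • g‖ ≤ ‖h‖ + t * ‖g‖ := by
      refine (norm_add_le _ _).trans ?_
      rw [norm_smul, norm_neg, Real.norm_of_nonneg ht.le]
    have h3 : ‖h + (-t) • g‖ ^ 3 ≤ (‖h‖ + t * ‖g‖) ^ 3 := by gcongr
    have h4 : M / 6 * ‖h + (-t) • g‖ ^ 3 ≤ M / 6 * (‖h‖ + t * ‖g‖) ^ 3 := by gcongr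
    simp only [cubicModel, map_smul, inner_smul_left, inner_smul_right,
      real_inner_self_eq_norm_sq] at h1
    simp at h1
    rw [neg_smul] at h4
    nlinarith [h1, h4]
  rcases (norm_nonneg g).eq_or_lt with h0 | h0
  · rw [← h0]; positivity
  · nlinarith

/-- Comparing with `h + s w` and `h - s w` and adding cancels the first-order term. For `s ‖w‖ ≥
‖h‖` both norms are at most `2 s ‖w‖`, which gives `8/3`, cruder than the sharp `1/2` but enough
here. -/
theorem curvature_ge_of_isMin (hM : 0 < M) (hU : (U : Vec d →ₗ[ℝ] Vec d).IsSymmetric)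
    (hmin : ∀ w, cubicModel M v U h ≤ cubicModel M v U w) (w : Vec d) :
    -(8 / 3 * M * ‖h‖) * ‖w‖ ^ 2 ≤ inner ℝ (U w) w := by
  by_cases hw0 : w = 0
  · simp [hw0]
  have hw : 0 < ‖w‖ := norm_pos_iff.mpr hw0
  have key : 0 ≤ inner ℝ (U w) w + 8 / 3 * M * ‖h‖ * ‖w‖ ^ 2 := by
    refine nonneg_of_cubic_nonneg (β := 8 / 3 * M * ‖w‖ ^ 3) (γ := 0) fun t ht => ?_
    -- The extra `t > 0` keeps `s` positive when `h = 0`; it tends to `0` at the end.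
    set s := ‖h‖ / ‖w‖ + t with hs
    have hs0 : 0 < s := by positivity
    have hsw : s * ‖w‖ = ‖h‖ + t * ‖w‖ := by rw [hs]; field_simp
    have b : ∀ r : ℝ, |r| = s → ‖h + r • w‖ ^ 3 ≤ (2 * (s * ‖w‖)) ^ 3 := by
      intro r hr
      have : ‖h + r • w‖ ≤ 2 * (s * ‖w‖) := by
        refine (norm_add_le _ _).trans ?_
        rw [norm_smul, Real.norm_eq_abs, hr]
        nlinarith
      gcongr
    have h1 := hmin (h + s • w)
    have h2 := hmin (h + (-s) • w)
    rw [cubicModel_add M v hU] at h1 h2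
    simp only [cubicModel, map_smul, inner_smul_left, inner_smul_right] at h1 h2
    simp at h1 h2
    have b1 : M / 6 * ‖h + s • w‖ ^ 3 ≤ M / 6 * (2 * (s * ‖w‖)) ^ 3 := by
      have := b s (abs_of_pos hs0); gcongr
    have b2 : M / 6 * ‖h + -(s • w)‖ ^ 3 ≤ M / 6 * (2 * (s * ‖w‖)) ^ 3 := by
      have := b (-s) (by rw [abs_neg, abs_of_pos hs0]); rw [neg_smul] at this; gcongr
    have h0 : 0 ≤ M / 6 * ‖h‖ ^ 3 := by positivity
    have h3 : 0 ≤ s ^ 2 * (inner ℝ (U w) w + 8 / 3 * M * (s * ‖w‖) * ‖w‖ ^ 2) := by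
      nlinarith [h1, h2, b1, b2, h0]
    have h4 : 0 ≤ inner ℝ (U w) w + 8 / 3 * M * (s * ‖w‖) * ‖w‖ ^ 2 :=
      nonneg_of_mul_nonneg_right h3 (by positivity)
    rw [hsw] at h4
    have h5 := mul_nonneg ht.le h4
    nlinarith [h5]
  linarith

/-- Stationarity along the ray through `h` expresses `⟨U h, h⟩` by `⟨v, h⟩` and `‖h‖³`, and
comparison with `-h` gives `⟨v, h⟩ ≤ 0`. What is left is `⟨v, h⟩ / 2 - M ‖h‖³ / 12`. -/
theorem cubicModel_le_of_isMin (hM : 0 < M) (hmin : ∀ w, cubicModel M v U h ≤ cubicModel M v U w) :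
    cubicModel M v U h ≤ -(M / 12) * ‖h‖ ^ 3 := by
  have e : ∀ s : ℝ, cubicModel M v U (s • h) = s * inner ℝ v h + s ^ 2 * ((1 / 2) *
      inner ℝ (U h) h) + |s| ^ 3 * (M / 6 * ‖h‖ ^ 3) := by
    intro s
    simp only [cubicModel, map_smul, inner_smul_left, inner_smul_right, norm_smul,
      Real.norm_eq_abs, mul_pow]
    simp
    ring
  have e1 := e 1
  have e2 := e (-1)
  simp at e1 e2
  have h2 := hmin (-h)
  have h3 : 0 ≤ inner ℝ v h + inner ℝ (U h) h + M / 2 * ‖h‖ ^ 3 := by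
    refine nonneg_of_cubic_nonneg (β := 1 / 2 * inner ℝ (U h) h + M / 2 * ‖h‖ ^ 3)
      (γ := M / 6 * ‖h‖ ^ 3) fun t ht => ?_
    have h1 := hmin ((1 + t) • h)
    rw [e, abs_of_pos (by linarith), e1] at h1
    nlinarith [h1]
  have h4 : 0 ≤ -(inner ℝ v h + inner ℝ (U h) h + M / 2 * ‖h‖ ^ 3) := by
    refine nonneg_of_cubic_nonneg (β := 1 / 2 * inner ℝ (U h) h + M / 2 * ‖h‖ ^ 3)
      (γ := M / 6 * ‖h‖ ^ 3) fun t ht => ?_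
    have h1 := hmin ((1 - t) • h)
    have h5 : |1 - t| ^ 3 ≤ 1 - 3 * t + 3 * t ^ 2 + t ^ 3 := by
      rcases abs_cases (1 - t) with ⟨h, _⟩ | ⟨h, h'⟩ <;> rw [h]
      · nlinarith [pow_pos ht 3]
      · nlinarith [pow_pos ht 3, sq_nonneg (t - 1)]
    have h6 := mul_le_mul_of_nonneg_right h5 (show 0 ≤ M / 6 * ‖h‖ ^ 3 by positivity)
    rw [e, e1] at h1
    nlinarith [h1, h6]
  have h7 : inner ℝ (U h) h = -inner ℝ v h - M / 2 * ‖h‖ ^ 3 := by linarith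
  rw [e1]
  rw [e1, e2] at h2
  rw [h7]
  linarith

end Minimizer

/-! ### Taylor estimates from the mean value inequality, with non-sharp constants. -/

section Taylor

variable {d : ℕ}

theorem norm_sub_linearization_le {G : Vec d → Vec d} {L : ℝ} (hG : Differentiable ℝ G)
    (hL : ∀ x y, ‖fderiv ℝ G x - fderiv ℝ G y‖ ≤ L * ‖x - y‖) (hL0 : 0 ≤ L) (x h : Vec d) :
    ‖G (x + h) - G x - fderiv ℝ G x h‖ ≤ L * ‖h‖ ^ 2 := by
  have := (convex_closedBall x ‖h‖).norm_image_sub_le_of_norm_fderiv_le' (𝕜 := ℝ) (f := G)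
    (φ := fderiv ℝ G x) (C := L * ‖h‖) (x := x) (y := x + h) (fun z _ => hG z)
    (fun z hz => (hL z x).trans (by
      have := mem_closedBall_iff_norm.mp hz
      gcongr)) (by simp) (by simp)
  rw [add_sub_cancel_left] at this
  rw [pow_two, ← mul_assoc]
  exact this

/-- The derivative of the Taylor remainder at `y` is the linearization error of the gradient, at
most `L ‖h‖²` on the ball of radius `‖h‖`. -/
theorem le_quadratic_model {F : Vec d → ℝ} {L : ℝ} (hF : Differentiable ℝ F)
    (hG : Differentiable ℝ (gradient F)) (hL : ∀ x y, ‖hess F x - hess F y‖ ≤ L * ‖x - y‖)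
    (hL0 : 0 ≤ L) (x : Vec d) (hs : (hess F x : Vec d →ₗ[ℝ] Vec d).IsSymmetric) (h : Vec d) :
    F (x + h) ≤ F x + inner ℝ (gradient F x) h + (1 / 2) * inner ℝ (hess F x h) h
      + L * ‖h‖ ^ 3 := by
  set H := hess F x with hH
  have key := (convex_closedBall (0 : Vec d) ‖h‖).norm_image_sub_le_of_norm_hasFDerivWithin_le
    (𝕜 := ℝ) (f := fun y => F (x + y) - inner ℝ (gradient F x) y - (1 / 2) * inner ℝ (H y) y)
    (f' := fun y => InnerProductSpace.toDual ℝ (Vec d) (gradient F (x + y) - gradient F x - H y))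
    (C := L * ‖h‖ ^ 2) (x := 0) (y := h) (fun y _ => ?_) (fun y hy => ?_) (by simp) (by simp)
  · have := (le_abs_self _).trans key
    simp only [inner_zero_right, map_zero, mul_zero, sub_zero, add_zero] at this
    nlinarith [this]
  · apply HasFDerivAt.hasFDerivWithinAt
    have h1 : HasFDerivAt (fun y => F (x + y)) (fderiv ℝ F (x + y)) y := by
      exact (hF (x + y)).hasFDerivAt.comp y ((hasFDerivAt_id y).const_add x)
    have h2 : HasFDerivAt (fun y : Vec d => inner ℝ (gradient F x) y)
        (InnerProductSpace.toDual ℝ (Vec d) (gradient F x)) y :=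
      (InnerProductSpace.toDual ℝ (Vec d) (gradient F x)).hasFDerivAt
    have h3 := (H.hasFDerivAt (x := y)).inner ℝ (hasFDerivAt_id y)
    refine ((h1.sub h2).sub (h3.const_mul (1 / 2))).congr_fderiv ?_
    ext w
    have h5 : inner ℝ (H w) y = inner ℝ (H y) w := by
      rw [real_inner_comm]; exact (hs y w).symm
    simp [h5]
    ring
  · rw [LinearIsometryEquiv.norm_map]
    have := norm_sub_linearization_le hG hL hL0 x y
    refine this.trans ?_
    have : ‖y‖ ≤ ‖h‖ := by simpa using hy
    gcongr

end Taylor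

/-! ### Independent uniform draws and exchangeable pairs. -/

theorem sum_update_eq {ι κ : Type*} [Fintype κ] [DecidableEq κ] {V : Type*}
    [AddCommGroup V] (a : ι → V) (I : κ → ι) (k : κ) (j : ι) :
    ∑ l, a (I l) - ∑ l, a (Function.update I k j l) = a (I k) - a j := by
  rw [← Finset.sum_sub_distrib, Finset.sum_eq_single k]
  · simp
  · intro l _ hl
    simp [Function.update_of_ne hl]
  · simp

section Resampling

variable {ι κ : Type*} [Fintype ι] [Fintype κ] [DecidableEq κ]

/-- Swapping the `k`-th index with a fresh index is an involution of the pairs `(I, j)`: a batch and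
its redrawn version are exchangeable. -/
theorem sum_resample (k : κ) (g : (κ → ι) → ι → ℝ) :
    ∑ I, ∑ j, g (Function.update I k j) (I k) = ∑ I, ∑ j, g I j := by
  have hinv : Function.Involutive
      (fun p : (κ → ι) × ι => (Function.update p.1 k p.2, p.1 k)) := by
    rintro ⟨I, j⟩
    simp
  rw [← Fintype.sum_prod_type', ← Fintype.sum_prod_type']
  exact Equiv.sum_comp hinv.toPerm (fun p : (κ → ι) × ι => g p.1 p.2)

/-- Centering allows `a j` to be subtracted for free, and exchanging the batch with its redrawn
version flips the sign of `a (I k) - a j`. The value is thus half a sum of differences of `G`, which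
are small since only one index changes. -/
theorem two_mul_card_mul_sum_eq {V : Type*} [AddCommGroup V] [Module ℝ V] {a : ι → V}
    (ha : ∑ i, a i = 0) (k : κ) (G : (κ → ι) → V →ₗ[ℝ] ℝ) :
    2 * (Fintype.card ι * ∑ I, G I (a (I k)))
      = ∑ I, ∑ j, (G I (a (I k) - a j) - G (Function.update I k j) (a (I k) - a j)) := by
  have h1 : ∑ I, ∑ j, G I (a (I k) - a j) = Fintype.card ι * ∑ I, G I (a (I k)) := by
    rw [Finset.mul_sum]
    refine Finset.sum_congr rfl fun I _ => ?_
    rw [← map_sum, Finset.sum_sub_distrib, ha, sub_zero]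
    simp
  have h2 : ∑ I, ∑ j, G (Function.update I k j) (a (I k) - a j)
      = -∑ I, ∑ j, G I (a (I k) - a j) := by
    rw [← sum_resample k (fun I j => G I (a (I k) - a j)), ← Finset.sum_neg_distrib]
    refine Finset.sum_congr rfl fun I _ => ?_
    rw [← Finset.sum_neg_distrib]
    refine Finset.sum_congr rfl fun j _ => ?_
    rw [Function.update_self, ← map_neg, neg_sub]
  simp only [Finset.sum_sub_distrib]
  rw [h2, h1]
  ring

/-- The second moment of a sum of independent uniform draws from a centered family. -/
theorem sum_norm_sq_le [Nonempty ι] {V : Type*} [NormedAddCommGroup V] [InnerProductSpace ℝ V]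
    {a : ι → V} {c : ℝ} (ha : ∑ i, a i = 0) (hc : ∀ i j, ‖a i - a j‖ ≤ c) :
    ∑ I : κ → ι, ‖∑ k, a (I k)‖ ^ 2
      ≤ Fintype.card (κ → ι) * (Fintype.card κ * (c ^ 2 / 2)) := by
  have hn : (0 : ℝ) < Fintype.card ι := by exact_mod_cast Fintype.card_pos
  have step : ∀ k : κ, ∑ I : κ → ι, (inner ℝ (∑ l, a (I l)) (a (I k)) : ℝ)
      ≤ Fintype.card (κ → ι) * (c ^ 2 / 2) := by
    intro k
    have h := two_mul_card_mul_sum_eq ha k (fun I => (innerSL ℝ (∑ l, a (I l))).toLinearMap)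
    have h2 : ∑ I : κ → ι, ∑ j, ((innerSL ℝ (∑ l, a (I l))).toLinearMap (a (I k) - a j)
        - (innerSL ℝ (∑ l, a (Function.update I k j l))).toLinearMap (a (I k) - a j))
        ≤ ∑ I : κ → ι, ∑ j : ι, c ^ 2 := by
      refine Finset.sum_le_sum fun I _ => Finset.sum_le_sum fun j _ => ?_
      have : ∀ x y z : V, (innerSL ℝ x).toLinearMap z - (innerSL ℝ y).toLinearMap z
          = inner ℝ (x - y) z := by
        intro x y z; rw [inner_sub_left]; rfl
      rw [this, sum_update_eq, real_inner_self_eq_norm_sq]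
      have := hc (I k) j
      gcongr
    rw [← h] at h2
    simp only [Finset.sum_const, nsmul_eq_mul, Finset.card_univ] at h2
    have h3 : (Fintype.card ι : ℝ) * ∑ I : κ → ι, (inner ℝ (∑ l, a (I l)) (a (I k)) : ℝ)
        ≤ Fintype.card ι * (Fintype.card (κ → ι) * (c ^ 2 / 2)) := by
      have h4 : ∀ I : κ → ι, (innerSL ℝ (∑ l, a (I l))).toLinearMap (a (I k))
        = (inner ℝ (∑ l, a (I l)) (a (I k)) : ℝ) := fun I => rfl
      simp only [h4] at h2
      linarith
    exact le_of_mul_le_mul_left h3 hn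
  have e : ∀ I : κ → ι, ‖∑ k, a (I k)‖ ^ 2 = ∑ k, (inner ℝ (∑ l, a (I l)) (a (I k)) : ℝ) := by
    intro I; rw [← inner_sum, real_inner_self_eq_norm_sq]
  simp only [e]
  rw [Finset.sum_comm]
  refine (Finset.sum_le_sum fun k _ => step k).trans (le_of_eq ?_)
  simp only [Finset.sum_const, nsmul_eq_mul, Finset.card_univ]
  ring

end Resampling

/-! ### Moments of sums of random symmetric matrices. -/

section TraceMoments

variable {d : ℕ}

theorem pow_sub_pow_eq_sum {R : Type*} [Ring R] (x y : R) (p : ℕ) :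
    x ^ (p + 1) - y ^ (p + 1) = ∑ q ∈ Finset.range (p + 1), x ^ q * (x - y) * y ^ (p - q) := by
  have h := Finset.sum_range_sub (fun q => x ^ q * y ^ (p + 1 - q)) (p + 1)
  simp only [Nat.sub_self, pow_zero, mul_one, Nat.sub_zero, one_mul] at h
  rw [← h]
  refine Finset.sum_congr rfl fun q hq => ?_
  have hq' : q ≤ p := by simpa [Nat.lt_succ_iff] using hq
  have h1 : p + 1 - (q + 1) = p - q := by omega
  have h2 : p + 1 - q = (p - q) + 1 := by omega
  rw [h1, h2, mul_sub, sub_mul, pow_succ x q, pow_succ' y (p - q), mul_assoc, mul_assoc]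

theorem pow_mul_pow_le_add (a b : ℝ) {q r m : ℕ} (h : q + r = 2 * m) :
    a ^ q * b ^ r ≤ a ^ (2 * m) + b ^ (2 * m) := by
  have ha : a ^ (2 * m) = |a| ^ (2 * m) := by rw [pow_mul, pow_mul, sq_abs]
  have hb : b ^ (2 * m) = |b| ^ (2 * m) := by rw [pow_mul, pow_mul, sq_abs]
  have h1 : a ^ q * b ^ r ≤ |a| ^ q * |b| ^ r := by
    rw [← abs_pow, ← abs_pow, ← abs_mul]; exact le_abs_self _
  rw [ha, hb]
  refine h1.trans ?_
  rcases le_total |a| |b| with hab | hab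
  · have : |a| ^ q * |b| ^ r ≤ |b| ^ q * |b| ^ r := by gcongr
    rw [← pow_add, h] at this
    have : 0 ≤ |a| ^ (2 * m) := by positivity
    linarith
  · have : |a| ^ q * |b| ^ r ≤ |a| ^ q * |a| ^ r := by gcongr
    rw [← pow_add, h] at this
    have : 0 ≤ |b| ^ (2 * m) := by positivity
    linarith

theorem pow_apply_eigenvectorBasis {X : Module.End ℝ (Vec d)} (hX : X.IsSymmetric)
    (hd : Module.finrank ℝ (Vec d) = d) (q : ℕ) (i : Fin d) :
    (X ^ q) (hX.eigenvectorBasis hd i) = hX.eigenvalues hd i ^ q • hX.eigenvectorBasis hd i := by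
  induction q with
  | zero => simp
  | succ q ih =>
    rw [pow_succ', Module.End.mul_apply, ih, map_smul, hX.apply_eigenvectorBasis hd i, pow_succ,
      mul_smul]
    simp

theorem trace_pow_eq {X : Module.End ℝ (Vec d)} (hX : X.IsSymmetric)
    (hd : Module.finrank ℝ (Vec d) = d) (q : ℕ) :
    LinearMap.trace ℝ (Vec d) (X ^ q) = ∑ i, hX.eigenvalues hd i ^ q := by
  rw [LinearMap.trace_eq_sum_inner _ (hX.eigenvectorBasis hd)]
  refine Finset.sum_congr rfl fun i _ => ?_
  rw [pow_apply_eigenvectorBasis, inner_smul_right, real_inner_self_eq_norm_sq,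
    (hX.eigenvectorBasis hd).norm_eq_one]
  simp

/-- In eigenbases `w` of `X` and `u` of `Y` the trace is the sum of `λ_i^q μ_j^r ⟨w_i, D u_j⟩²`. The
eigenvalue products split into pure even powers, and the squares sum over rows or columns to `‖D
u_j‖²` or `‖D w_i‖²`. -/
theorem trace_mul_pow_mul_pow_le {X Y D : Module.End ℝ (Vec d)} (hX : X.IsSymmetric)
    (hY : Y.IsSymmetric) (hD : D.IsSymmetric) {c : ℝ}
    (hc : ∀ u, ‖D u‖ ≤ c * ‖u‖) {q r m : ℕ} (h : q + r = 2 * m) :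
    LinearMap.trace ℝ (Vec d) (D * (X ^ q * D * Y ^ r))
      ≤ c ^ 2 * (LinearMap.trace ℝ (Vec d) (X ^ (2 * m))
        + LinearMap.trace ℝ (Vec d) (Y ^ (2 * m))) := by
  have hd : Module.finrank ℝ (Vec d) = d := finrank_euclideanSpace_fin
  set w := hX.eigenvectorBasis hd with hw
  set u := hY.eigenvectorBasis hd with hu
  set lam := hX.eigenvalues hd with hlam
  set mu' := hY.eigenvalues hd with hmu
  have hDsq : ∀ x : Vec d, ‖x‖ = 1 → ‖D x‖ ^ 2 ≤ c ^ 2 := by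
    intro x hx
    have := hc x
    rw [hx, mul_one] at this
    gcongr
  have hXq : (X ^ q).IsSymmetric := by
    induction q generalizing r m with
    | zero => simp [LinearMap.IsSymmetric]
    | succ q _ => exact hX.pow _
  have e1 : LinearMap.trace ℝ (Vec d) (D * (X ^ q * D * Y ^ r))
      = ∑ j, ∑ i, (lam i ^ q * mu' j ^ r) * (inner ℝ (w i) (D (u j))) ^ 2 := by
    rw [LinearMap.trace_eq_sum_inner _ u]
    refine Finset.sum_congr rfl fun j _ => ?_
    simp only [Module.End.mul_apply]
    rw [hu, pow_apply_eigenvectorBasis, ← hu, ← hmu, map_smul, map_smul, map_smul,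
      inner_smul_right, ← hD, ← w.sum_inner_mul_inner, Finset.mul_sum]
    refine Finset.sum_congr rfl fun i _ => ?_
    rw [← hXq, hw, pow_apply_eigenvectorBasis, ← hw, ← hlam, inner_smul_left,
      real_inner_comm (w i) (D (u j))]
    simp
    ring
  rw [e1, trace_pow_eq hX hd, trace_pow_eq hY hd, ← hlam, ← hmu]
  have e2 : ∑ j, ∑ i, (lam i ^ q * mu' j ^ r) * (inner ℝ (w i) (D (u j))) ^ 2
      ≤ ∑ j, ∑ i, (lam i ^ (2 * m) + mu' j ^ (2 * m)) * (inner ℝ (w i) (D (u j))) ^ 2 :=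
    Finset.sum_le_sum fun j _ => Finset.sum_le_sum fun i _ =>
      mul_le_mul_of_nonneg_right (pow_mul_pow_le_add _ _ h) (sq_nonneg _)
  refine e2.trans ?_
  have e3 : ∀ j, ∑ i, (inner ℝ (w i) (D (u j)) : ℝ) ^ 2 = ‖D (u j)‖ ^ 2 := by
    intro j
    simpa using w.sum_sq_norm_inner_right (D (u j))
  have e4 : ∀ i, ∑ j, (inner ℝ (w i) (D (u j)) : ℝ) ^ 2 = ‖D (w i)‖ ^ 2 := by
    intro i
    rw [← u.sum_sq_norm_inner_left (D (w i))]
    refine Finset.sum_congr rfl fun j _ => ?_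
    rw [← hD]; simp
  simp only [add_mul, Finset.sum_add_distrib]
  rw [Finset.sum_comm, mul_add, Finset.mul_sum, Finset.mul_sum]
  have hev : ∀ x : ℝ, 0 ≤ x ^ (2 * m) := fun x => by rw [pow_mul]; positivity
  refine add_le_add (Finset.sum_le_sum fun i _ => ?_) (Finset.sum_le_sum fun j _ => ?_)
  · rw [← Finset.mul_sum, e4, mul_comm]
    exact mul_le_mul_of_nonneg_right (hDsq _ (w.norm_eq_one i)) (hev _)
  · rw [← Finset.mul_sum, e3, mul_comm]
    exact mul_le_mul_of_nonneg_right (hDsq _ (u.norm_eq_one j)) (hev _)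

theorem norm_pow_le_trace {X : Op d} (hX : (X : Module.End ℝ (Vec d)).IsSymmetric) {m : ℕ}
    (hm : 0 < m) :
    ‖X‖ ^ (2 * m) ≤ LinearMap.trace ℝ (Vec d) ((X : Module.End ℝ (Vec d)) ^ (2 * m)) := by
  have hd : Module.finrank ℝ (Vec d) = d := finrank_euclideanSpace_fin
  rw [trace_pow_eq hX hd]
  set w := hX.eigenvectorBasis hd with hw
  set lam := hX.eigenvalues hd with hlam
  have hev : ∀ x : ℝ, 0 ≤ x ^ (2 * m) := fun x => by rw [pow_mul]; positivity
  rcases isEmpty_or_nonempty (Fin d) with hE | hE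
  · have : X = 0 := by ext x i; exact hE.elim i
    rw [this, norm_zero, zero_pow (by omega)]
    exact Finset.sum_nonneg fun i _ => hev _
  obtain ⟨i, hi⟩ := Finite.exists_max (fun i => |lam i|)
  have h1 : ‖X‖ ≤ |lam i| := by
    refine X.opNorm_le_bound (abs_nonneg _) fun x => ?_
    refine le_of_sq_le_sq ?_ (by positivity)
    rw [mul_pow, ← w.sum_sq_norm_inner_right (X x), ← w.sum_sq_norm_inner_right x, Finset.mul_sum]
    refine Finset.sum_le_sum fun j _ => ?_
    have : (inner ℝ (w j) (X x) : ℝ) = lam j * inner ℝ (w j) x := by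
      have h2 := hX (w j) x
      rw [hw, hX.apply_eigenvectorBasis hd j, ← hw, ← hlam, inner_smul_left] at h2
      simpa using h2.symm
    rw [this, norm_mul, mul_pow]
    have := hi j
    rw [Real.norm_eq_abs]
    gcongr
  calc ‖X‖ ^ (2 * m) ≤ |lam i| ^ (2 * m) := by gcongr
    _ = lam i ^ (2 * m) := by rw [pow_mul, pow_mul, sq_abs]
    _ ≤ _ := Finset.single_le_sum (f := fun i => lam i ^ (2 * m)) (fun i _ => hev _)
      (Finset.mem_univ i)

theorem isSymmetric_sum {κ : Type*} (s : Finset κ) {A : κ → Module.End ℝ (Vec d)}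
    (hA : ∀ i, (A i).IsSymmetric) : (∑ i ∈ s, A i).IsSymmetric := by
  classical
  induction s using Finset.induction_on with
  | empty => simp
  | insert a s ha ih => rw [Finset.sum_insert ha]; exact (hA a).add ih

variable {ι κ : Type*} [Fintype ι] [Fintype κ] [Nonempty ι] [DecidableEq κ]

/-- Split off one factor as `∑ k, A (I k)` and redraw index `k`. The difference of the two powers
telescopes into `2 m + 1` terms, each controlled by the traces of the old and the new `2 m`-th
power. These have equal averages, so the resulting `2` cancels the half from exchangeability. -/
theorem sum_trace_pow_succ_le {A : ι → Module.End ℝ (Vec d)} (hA : ∀ i, (A i).IsSymmetric)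
    (h0 : ∑ i, A i = 0) {c : ℝ} (hc : ∀ i j u, ‖A i u - A j u‖ ≤ c * ‖u‖) (m : ℕ) :
    ∑ I : κ → ι, LinearMap.trace ℝ (Vec d) ((∑ k, A (I k)) ^ (2 * (m + 1)))
      ≤ (Fintype.card κ * ((2 * m + 1 : ℕ) * c ^ 2)) *
        ∑ I : κ → ι, LinearMap.trace ℝ (Vec d) ((∑ k, A (I k)) ^ (2 * m)) := by
  set tr := LinearMap.trace ℝ (Vec d) with htr
  set X : (κ → ι) → Module.End ℝ (Vec d) := fun I => ∑ k, A (I k) with hXdef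
  have hXs : ∀ I, (X I).IsSymmetric := fun I => isSymmetric_sum _ fun k => hA (I k)
  have hn : (0 : ℝ) < Fintype.card ι := by exact_mod_cast Fintype.card_pos
  set S := ∑ I : κ → ι, tr (X I ^ (2 * m)) with hS
  have step : ∀ k : κ, ∑ I : κ → ι, tr (A (I k) * X I ^ (2 * m + 1))
      ≤ ((2 * m + 1 : ℕ) * c ^ 2) * S := by
    intro k
    have h := two_mul_card_mul_sum_eq h0 k
      (fun I => tr ∘ₗ LinearMap.mulRight ℝ (X I ^ (2 * m + 1)))
    simp only [LinearMap.comp_apply, LinearMap.mulRight_apply] at h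
    have h2 : ∑ I : κ → ι, ∑ j, (tr ((A (I k) - A j) * X I ^ (2 * m + 1))
        - tr ((A (I k) - A j) * X (Function.update I k j) ^ (2 * m + 1)))
        ≤ ∑ I : κ → ι, ∑ j, ((2 * m + 1 : ℕ) * c ^ 2) *
          (tr (X I ^ (2 * m)) + tr (X (Function.update I k j) ^ (2 * m))) := by
      refine Finset.sum_le_sum fun I _ => Finset.sum_le_sum fun j _ => ?_
      rw [← map_sub, ← mul_sub, pow_sub_pow_eq_sum, ← sum_update_eq A I k j, Finset.mul_sum,
        map_sum]
      have : ∀ q ∈ Finset.range (2 * m + 1), tr ((X I - X (Function.update I k j)) *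
          (X I ^ q * (X I - X (Function.update I k j)) *
            X (Function.update I k j) ^ (2 * m - q)))
          ≤ c ^ 2 * (tr (X I ^ (2 * m)) + tr (X (Function.update I k j) ^ (2 * m))) := by
        intro q hq
        have hq' : q ≤ 2 * m := by simpa [Nat.lt_succ_iff] using hq
        refine trace_mul_pow_mul_pow_le (hXs _) (hXs _) ((hXs _).sub (hXs _))
          (fun u => ?_) (by omega)
        rw [hXdef, sum_update_eq A I k j]
        exact hc _ _ u
      refine (Finset.sum_le_sum this).trans (le_of_eq ?_)
      rw [Finset.sum_const, Finset.card_range, nsmul_eq_mul, mul_assoc]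
    rw [← h] at h2
    have h3 : ∑ I : κ → ι, ∑ j : ι, tr (X (Function.update I k j) ^ (2 * m))
        = ∑ I : κ → ι, ∑ j : ι, tr (X I ^ (2 * m)) :=
      sum_resample k (fun I _ => tr (X I ^ (2 * m)))
    have h5 : ∑ I : κ → ι, ∑ j : ι, tr (X I ^ (2 * m)) = Fintype.card ι * S := by
      rw [hS, Finset.mul_sum]; simp
    simp only [← Finset.mul_sum, Finset.sum_add_distrib] at h2
    rw [h3, h5] at h2
    have h4 : (Fintype.card ι : ℝ) * ∑ I : κ → ι, tr (A (I k) * X I ^ (2 * m + 1))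
        ≤ Fintype.card ι * (((2 * m + 1 : ℕ) * c ^ 2) * S) := by linarith
    exact le_of_mul_le_mul_left h4 hn
  have e : ∀ I : κ → ι, tr (X I ^ (2 * (m + 1))) = ∑ k, tr (A (I k) * X I ^ (2 * m + 1)) := by
    intro I
    rw [← map_sum, ← Finset.sum_mul, show 2 * (m + 1) = (2 * m + 1) + 1 by ring, pow_succ']
  change ∑ I, tr (X I ^ (2 * (m + 1))) ≤ _ * S
  simp only [e]
  rw [Finset.sum_comm]
  refine (Finset.sum_le_sum fun k _ => step k).trans (le_of_eq ?_)
  rw [Finset.sum_const, nsmul_eq_mul, Finset.card_univ]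
  ring

theorem sum_trace_pow_le {A : ι → Module.End ℝ (Vec d)} (hA : ∀ i, (A i).IsSymmetric)
    (h0 : ∑ i, A i = 0) {c : ℝ} (hc : ∀ i j u, ‖A i u - A j u‖ ≤ c * ‖u‖) {p : ℕ}
    (m : ℕ) (hm : m ≤ p) :
    ∑ I : κ → ι, LinearMap.trace ℝ (Vec d) ((∑ k, A (I k)) ^ (2 * m))
      ≤ Fintype.card (κ → ι) * (d * (2 * p * Fintype.card κ * c ^ 2) ^ m) := by
  induction m with
  | zero =>
    simp only [mul_zero, pow_zero, mul_one]
    rw [LinearMap.trace_one, finrank_euclideanSpace_fin]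
    simp
  | succ m ih =>
    refine (sum_trace_pow_succ_le hA h0 hc m).trans ?_
    refine (mul_le_mul_of_nonneg_left (ih (by omega)) (by positivity)).trans ?_
    have h1 : ((2 * m + 1 : ℕ) : ℝ) ≤ 2 * p := by
      have : 2 * m + 1 ≤ 2 * p := by omega
      exact_mod_cast this
    have h2 : (Fintype.card κ * ((2 * m + 1 : ℕ) * c ^ 2) : ℝ) ≤ 2 * p * Fintype.card κ * c ^ 2 := by
      calc (Fintype.card κ * ((2 * m + 1 : ℕ) * c ^ 2) : ℝ)
          ≤ Fintype.card κ * ((2 * p) * c ^ 2) := by gcongr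
        _ = _ := by ring
    refine (mul_le_mul_of_nonneg_right h2 (by positivity)).trans (le_of_eq ?_)
    ring

theorem cube_le_add_pow {z R : ℝ} (hz : 0 ≤ z) (hR : 0 < R) {p : ℕ} (hp : 2 ≤ p) :
    z ^ 3 ≤ R ^ 3 * (1 + z ^ (2 * p) / R ^ (2 * p)) := by
  have h : (z / R) ^ 3 ≤ 1 + (z / R) ^ (2 * p) := by
    rcases le_total (z / R) 1 with h1 | h1
    · have := pow_le_one₀ (n := 3) (by positivity) h1
      have : 0 ≤ (z / R) ^ (2 * p) := by positivity
      linarith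
    · have := pow_le_pow_right₀ h1 (show 3 ≤ 2 * p by omega)
      linarith
  rw [div_pow, div_pow, div_le_iff₀ (by positivity)] at h
  linarith

/-- The third moment of the norm of a sum of independent uniform draws from a centered family of
symmetric operators. -/
theorem sum_norm_cube_le {A : ι → Op d} (hA : ∀ i, (A i : Module.End ℝ (Vec d)).IsSymmetric)
    (h0 : ∑ i, A i = 0) {c R : ℝ} (hc : ∀ i j, ‖A i - A j‖ ≤ c) (hd : 2 ≤ d)
    (hR : 0 < R) (hRc : 24 * Real.log d * Fintype.card κ * c ^ 2 ≤ R ^ 2) :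
    ∑ I : κ → ι, ‖∑ k, A (I k)‖ ^ 3 ≤ Fintype.card (κ → ι) * (2 * R ^ 3) := by
  have hdpos : (0 : ℝ) < d := by positivity
  have hlog : 2 / 3 ≤ Real.log d := by
    have h1 := Real.log_two_gt_d9
    have h2 : Real.log 2 ≤ Real.log d := Real.log_le_log (by norm_num) (by exact_mod_cast hd)
    linarith
  -- Moment order `2 p` with `p` about `log d`: then `d ≤ 3 ^ p`, so the dimension in the trace
  -- bound costs only a constant factor after taking `p`-th roots.
  set p := ⌈Real.log d⌉₊ + 1 with hp
  have hp2 : 2 ≤ p := by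
    have : 0 < ⌈Real.log d⌉₊ := Nat.ceil_pos.mpr (by linarith)
    omega
  have hp_ge : Real.log d ≤ p := by
    have := Nat.le_ceil (Real.log d)
    rw [hp]; push_cast; linarith
  have hp_le : 2 * (p : ℝ) ≤ 8 * Real.log d := by
    have := Nat.ceil_lt_add_one (show 0 ≤ Real.log d by linarith)
    rw [hp]; push_cast; linarith
  have hd3 : (d : ℝ) ≤ 3 ^ p := by
    have h1 : (d : ℝ) = Real.exp (Real.log d) := (Real.exp_log hdpos).symm
    rw [h1]
    calc Real.exp (Real.log d) ≤ Real.exp p := Real.exp_le_exp.mpr hp_ge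
      _ = Real.exp 1 ^ p := by rw [← Real.exp_nat_mul, mul_one]
      _ ≤ 3 ^ p := by
        have := Real.exp_one_lt_d9
        have h2 := Real.exp_pos 1
        gcongr
        linarith
  set B : ι → Module.End ℝ (Vec d) := fun i => (A i : Module.End ℝ (Vec d)) with hB
  have hB0 : ∑ i, B i = 0 := by
    rw [hB, ← ContinuousLinearMap.toLinearMap_sum, h0]; rfl
  have hBc : ∀ i j u, ‖B i u - B j u‖ ≤ c * ‖u‖ := by
    intro i j u
    exact (A i - A j).le_of_opNorm_le (hc i j) u
  have htr := sum_trace_pow_le (κ := κ) hA hB0 hBc p le_rfl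
  have hmom : ∑ I : κ → ι, ‖∑ k, A (I k)‖ ^ (2 * p)
      ≤ Fintype.card (κ → ι) * R ^ (2 * p) := by
    have h1 : ∀ I : κ → ι, ‖∑ k, A (I k)‖ ^ (2 * p)
        ≤ LinearMap.trace ℝ (Vec d) ((∑ k, B (I k)) ^ (2 * p)) := by
      intro I
      have e : ((∑ k, A (I k) : Op d) : Module.End ℝ (Vec d)) = ∑ k, B (I k) := by
        rw [ContinuousLinearMap.toLinearMap_sum]
      rw [← e]
      refine norm_pow_le_trace ?_ (by omega)
      rw [e]
      exact isSymmetric_sum _ fun k => hA (I k)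
    refine ((Finset.sum_le_sum fun I _ => h1 I).trans htr).trans ?_
    gcongr
    have h2 : 2 * p * Fintype.card κ * c ^ 2 ≤ R ^ 2 / 3 := by
      have : 2 * p * Fintype.card κ * c ^ 2 ≤ 8 * Real.log d * Fintype.card κ * c ^ 2 := by gcongr
      linarith
    calc (d : ℝ) * (2 * p * Fintype.card κ * c ^ 2) ^ p ≤ 3 ^ p * (R ^ 2 / 3) ^ p := by gcongr
      _ = R ^ (2 * p) := by rw [← mul_pow, pow_mul]; congr 1; ring
  calc ∑ I : κ → ι, ‖∑ k, A (I k)‖ ^ 3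
      ≤ ∑ I : κ → ι, R ^ 3 * (1 + ‖∑ k, A (I k)‖ ^ (2 * p) / R ^ (2 * p)) :=
        Finset.sum_le_sum fun I _ => cube_le_add_pow (norm_nonneg _) hR hp2
    _ = R ^ 3 * (Fintype.card (κ → ι) + (∑ I : κ → ι, ‖∑ k, A (I k)‖ ^ (2 * p)) / R ^ (2 * p)) := by
        rw [← Finset.mul_sum, Finset.sum_add_distrib, Finset.sum_div]; simp
    _ ≤ R ^ 3 * (Fintype.card (κ → ι) + Fintype.card (κ → ι)) := by
        have : (∑ I : κ → ι, ‖∑ k, A (I k)‖ ^ (2 * p)) / R ^ (2 * p) ≤ Fintype.card (κ → ι) := by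
          rw [div_le_iff₀ (by positivity)]; exact hmom
        gcongr
    _ = _ := by ring

end TraceMoments

/-! ### Gradients and Hessians of the components and of the average. -/

section Derivatives

variable {d : ℕ} {g : Vec d → ℝ}

theorem differentiable_gradient (hg : ContDiff ℝ 2 g) : Differentiable ℝ (gradient g) := by
  rw [differentiable_euclidean]
  intro i
  have h1 : Differentiable ℝ (fderiv ℝ g) :=
    (hg.fderiv_right (m := 1) (by norm_num)).differentiable (by norm_num)
  have h2 : (fun x => gradient g x i) = fun x => fderiv ℝ g x (EuclideanSpace.single i 1) := by
    ext x
    rw [← inner_gradient_left, EuclideanSpace.inner_single_right]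
    simp
  rw [h2]
  exact fun x => (h1 x).clm_apply (differentiableAt_const _)

theorem inner_hess (hg : ContDiff ℝ 2 g) (x u w : Vec d) :
    inner ℝ (hess g x u) w = fderiv ℝ (fderiv ℝ g) x u w := by
  have h1 : Differentiable ℝ (fderiv ℝ g) :=
    (hg.fderiv_right (m := 1) (by norm_num)).differentiable (by norm_num)
  have h2 : HasFDerivAt (fun y => (inner ℝ (gradient g y) w : ℝ))
      ((innerSL ℝ w).comp (hess g x)) x := by
    have := (innerSL ℝ w).hasFDerivAt.comp x (differentiable_gradient hg x).hasFDerivAt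
    refine this.congr_of_eventuallyEq (Filter.Eventually.of_forall fun y => ?_)
    exact real_inner_comm _ _
  have h3 : HasFDerivAt (fun y => (inner ℝ (gradient g y) w : ℝ))
      ((fderiv ℝ (fderiv ℝ g) x).flip w) x := by
    have e : (fun y => (inner ℝ (gradient g y) w : ℝ)) = fun y => fderiv ℝ g y w := by
      ext y; exact inner_gradient_left
    rw [e]
    have := (h1 x).hasFDerivAt.clm_apply (hasFDerivAt_const w x)
    simpa using this
  have h4 := congrArg (fun T => T u) (h2.unique h3)
  simp only [ContinuousLinearMap.comp_apply, ContinuousLinearMap.flip_apply] at h4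
  rw [← h4, real_inner_comm]
  rfl

theorem hess_isSymmetric (hg : ContDiff ℝ 2 g) (x : Vec d) :
    (hess g x : Vec d →ₗ[ℝ] Vec d).IsSymmetric := by
  intro u w
  have h := (hg.contDiffAt (x := x)).isSymmSndFDerivAt (by simp)
  have h1 := inner_hess hg x u w
  have h2 := inner_hess hg x w u
  rw [real_inner_comm] at h2
  exact (h1.trans (h u w)).trans h2.symm

variable {n : ℕ} {f : Fin n → Vec d → ℝ}

theorem contDiff_objective (hf : ∀ i, ContDiff ℝ 2 (f i)) : ContDiff ℝ 2 (objective f) :=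
  contDiff_const.mul (ContDiff.sum fun i _ => hf i)

theorem gradient_objective (hf : ∀ i, ContDiff ℝ 2 (f i)) :
    gradient (objective f) = fullGrad f := by
  ext1 x
  refine ext_inner_right ℝ fun w => ?_
  have hd : ∀ i, DifferentiableAt ℝ (f i) x := fun i => (hf i).differentiable (by norm_num) x
  rw [inner_gradient_left, fullGrad, inner_smul_left, sum_inner]
  simp only [inner_gradient_left]
  have : HasFDerivAt (objective f) ((1 / (n : ℝ)) • ∑ i, fderiv ℝ (f i) x) x :=
    (HasFDerivAt.fun_sum fun i _ => (hd i).hasFDerivAt).const_mul _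
  rw [this.fderiv]
  simp

theorem hess_objective (hf : ∀ i, ContDiff ℝ 2 (f i)) : hess (objective f) = fullHess f := by
  ext1 x
  rw [hess, gradient_objective hf]
  have : HasFDerivAt (fullGrad f) ((1 / (n : ℝ)) • ∑ i, hess (f i) x) x :=
    (HasFDerivAt.fun_sum fun i _ => (differentiable_gradient (hf i) x).hasFDerivAt).fun_const_smul _
  exact this.fderiv

theorem norm_fullHess_sub_le [NeZero n] {L : ℝ}
    (hL : ∀ i x y, ‖hess (f i) x - hess (f i) y‖ ≤ L * ‖x - y‖) (x y : Vec d) :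
    ‖fullHess f x - fullHess f y‖ ≤ L * ‖x - y‖ := by
  have hn : (0 : ℝ) < n := by exact_mod_cast Nat.pos_of_neZero n
  have e : fullHess f x - fullHess f y
      = (1 / (n : ℝ)) • ∑ i, (hess (f i) x - hess (f i) y) := by
    rw [Finset.sum_sub_distrib]
    exact (smul_sub _ _ _).symm
  rw [e, norm_smul, Real.norm_of_nonneg (by positivity)]
  have h1 : ‖∑ i, (hess (f i) x - hess (f i) y)‖ ≤ n * (L * ‖x - y‖) := by
    refine (norm_sum_le _ _).trans ((Finset.sum_le_sum fun i _ => hL i x y).trans ?_)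
    simp
  rw [one_div, inv_mul_le_iff₀ hn]
  exact h1

theorem semiHess_isSymmetric {B : ℕ} (hf : ∀ i, ContDiff ℝ 2 (f i)) (xr x : Vec d)
    (I : Fin B → Fin n) : (semiHess f xr x I : Vec d →ₗ[ℝ] Vec d).IsSymmetric := by
  have h : ∀ i y, IsSelfAdjoint (hess (f i) y) := fun i y =>
    ContinuousLinearMap.isSelfAdjoint_iff_isSymmetric.mpr (hess_isSymmetric (hf i) y)
  refine ContinuousLinearMap.isSelfAdjoint_iff_isSymmetric.mp ?_
  refine IsSelfAdjoint.add ((IsSelfAdjoint.all (1 / (B : ℝ))).smul ?_)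
    ((IsSelfAdjoint.all (1 / (n : ℝ))).smul ?_)
  · exact isSelfAdjoint_sum _ fun k _ => (h _ _).sub (h _ _)
  · exact isSelfAdjoint_sum _ fun k _ => h _ _

end Derivatives

/-! ### Moments of the semi-stochastic estimators. -/

section Sampling

theorem semiGrad_self {d n b : ℕ} {f : Fin n → Vec d → ℝ} (x : Vec d) (I : Fin b → Fin n) :
   
    semiGrad f x x I = fullGrad f x := by simp [semiGrad]

theorem semiHess_self {d n b : ℕ} {f : Fin n → Vec d → ℝ} (x : Vec d) (I : Fin b → Fin n) :
   
    semiHess f x x I = fullHess f x := by simp [semiHess]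

theorem sum_sub_mean {n : ℕ} [NeZero n] {V : Type*} [AddCommGroup V] [Module ℝ V]
    (Y : Fin n → V) : ∑ i, (Y i - (1 / (n : ℝ)) • ∑ j, Y j) = 0 := by
  have hn : (n : ℝ) ≠ 0 := by exact_mod_cast NeZero.ne n
  rw [Finset.sum_sub_distrib, Finset.sum_const, Finset.card_univ, Fintype.card_fin,
    ← Nat.cast_smul_eq_nsmul ℝ, smul_smul, mul_one_div_cancel hn, one_smul, sub_self]

theorem smul_sum_sub {b : ℕ} (hb : 0 < b) {V : Type*} [AddCommGroup V] [Module ℝ V]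
    (Y : Fin b → V) (m : V) :
    (1 / (b : ℝ)) • (∑ k, Y k) - m = (1 / (b : ℝ)) • ∑ k, (Y k - m) := by
  have hn : (b : ℝ) ≠ 0 := by positivity
  rw [Finset.sum_sub_distrib, smul_sub, Finset.sum_const, Finset.card_univ, Fintype.card_fin,
    ← Nat.cast_smul_eq_nsmul ℝ, smul_smul, one_div_mul_cancel hn, one_smul]

theorem semiGrad_sub {d n b : ℕ} {f : Fin n → Vec d → ℝ} (hb : 0 < b)
    (xr x : Vec d) (I : Fin b → Fin n) :
    semiGrad f xr x I - fullGrad f x = (1 / (b : ℝ)) • ∑ k,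
      ((gradient (f (I k)) x - gradient (f (I k)) xr)
        - (1 / (n : ℝ)) • ∑ i, (gradient (f i) x - gradient (f i) xr)) := by
  rw [← smul_sum_sub hb, semiGrad, fullGrad, fullGrad]
  simp only [Finset.sum_sub_distrib, smul_sub]
  abel

theorem semiHess_sub {d n b : ℕ} {f : Fin n → Vec d → ℝ} (hb : 0 < b)
    (xr x : Vec d) (I : Fin b → Fin n) :
    semiHess f xr x I - fullHess f x = (1 / (b : ℝ)) • ∑ k,
      ((hess (f (I k)) x - hess (f (I k)) xr)
        - (1 / (n : ℝ)) • ∑ i, (hess (f i) x - hess (f i) xr)) := by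
  rw [← smul_sum_sub hb, semiHess, fullHess, fullHess]
  simp only [Finset.sum_sub_distrib, smul_sub]
  abel

variable {d n : ℕ} [NeZero n] {f : Fin n → Vec d → ℝ}

theorem norm_sub_sub_sub_le {V : Type*} [SeminormedAddCommGroup V] {a b m : V} {c : ℝ}
    (ha : ‖a‖ ≤ c) (hb : ‖b‖ ≤ c) : ‖(a - m) - (b - m)‖ ≤ 2 * c := by
  rw [sub_sub_sub_cancel_right]
  exact (norm_sub_le _ _).trans (by linarith)

theorem sum_norm_semiGrad_sub_sq_le {L : ℝ}
    (hL : ∀ i x y, ‖gradient (f i) x - gradient (f i) y‖ ≤ L * ‖x - y‖) {b : ℕ} (hb : 0 < b)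
    (xr x : Vec d) :
    ∑ I : Fin b → Fin n, ‖semiGrad f xr x I - fullGrad f x‖ ^ 2
      ≤ Fintype.card (Fin b → Fin n) * (2 * L ^ 2 * ‖x - xr‖ ^ 2 / b) := by
  have hb' : (0 : ℝ) < b := by exact_mod_cast hb
  have h := sum_norm_sq_le (κ := Fin b) (a := fun i => (gradient (f i) x - gradient (f i) xr)
        - (1 / (n : ℝ)) • ∑ i, (gradient (f i) x - gradient (f i) xr))
    (sum_sub_mean _) (c := 2 * (L * ‖x - xr‖)) (fun i j => norm_sub_sub_sub_le (hL _ _ _) (hL _ _ _))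
  simp only [semiGrad_sub hb, norm_smul, mul_pow]
  rw [← Finset.mul_sum]
  refine (mul_le_mul_of_nonneg_left h (by positivity)).trans (le_of_eq ?_)
  rw [Fintype.card_fin b]
  simp
  field_simp

/-- Here `θ` stands for `(C_h n)^{1/3}`, so the hypothesis on `b` says that the batch has at least
`D_h` draws. -/
theorem sum_norm_semiHess_sub_cube_le (hf : ∀ i, ContDiff ℝ 2 (f i)) {L : ℝ} (hL0 : 0 < L)
    (hL : ∀ i x y, ‖hess (f i) x - hess (f i) y‖ ≤ L * ‖x - y‖) (hd : 2 ≤ d) {b : ℕ} {θ : ℝ}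
    (hθ : 0 < θ) (hb : Real.log d * θ ^ 2 ≤ b) (xr x : Vec d) :
    ∑ I : Fin b → Fin n, ‖semiHess f xr x I - fullHess f x‖ ^ 3
      ≤ Fintype.card (Fin b → Fin n) * (2000 * L ^ 3 * ‖x - xr‖ ^ 3 / θ ^ 3) := by
  rcases (norm_nonneg (x - xr)).eq_or_lt with h0 | hr
  · have : x = xr := by rw [← sub_eq_zero, ← norm_eq_zero, ← h0]
    subst this
    simp [semiHess_self]
  have hlog : 0 < Real.log d := Real.log_pos (by exact_mod_cast (by omega : 1 < d))
  have hb' : (0 : ℝ) < b := lt_of_lt_of_le (by positivity) hb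
  have hb0 : 0 < b := by exact_mod_cast hb'
  have hsa : ∀ i y, IsSelfAdjoint (hess (f i) y) := fun i y =>
    ContinuousLinearMap.isSelfAdjoint_iff_isSymmetric.mpr (hess_isSymmetric (hf i) y)
  have h := sum_norm_cube_le (κ := Fin b) (A := fun i => (hess (f i) x - hess (f i) xr)
        - (1 / (n : ℝ)) • ∑ i, (hess (f i) x - hess (f i) xr))
    (fun i => ContinuousLinearMap.isSelfAdjoint_iff_isSymmetric.mp (((hsa _ _).sub (hsa _ _)).sub
      ((IsSelfAdjoint.all (1 / (n : ℝ))).smul (isSelfAdjoint_sum _ fun k _ =>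
        (hsa _ _).sub (hsa _ _)))))
    (sum_sub_mean _) (c := 2 * (L * ‖x - xr‖)) (R := b * (10 * L * ‖x - xr‖ / θ))
    (fun i j => norm_sub_sub_sub_le (hL _ _ _) (hL _ _ _)) hd (by positivity) ?_
  · simp only [semiHess_sub hb0, norm_smul, mul_pow]
    rw [← Finset.mul_sum]
    refine (mul_le_mul_of_nonneg_left h (by positivity)).trans (le_of_eq ?_)
    simp
    field_simp
    ring
  · rw [Fintype.card_fin]
    have e : (b * (10 * L * ‖x - xr‖ / θ)) ^ 2
        = 100 * b * (b / θ ^ 2) * (L * ‖x - xr‖) ^ 2 := by field_simp; norm_num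
    rw [e]
    have h1 : Real.log d ≤ b / θ ^ 2 := by rw [le_div_iff₀ (by positivity)]; exact hb
    calc 24 * Real.log d * b * (2 * (L * ‖x - xr‖)) ^ 2
        = 96 * b * Real.log d * (L * ‖x - xr‖) ^ 2 := by ring
      _ ≤ 100 * b * (b / θ ^ 2) * (L * ‖x - xr‖) ^ 2 := by gcongr; norm_num

end Sampling

/-! ### The measure `μ` and one inexact cubic step. -/

section Step

theorem rpow_three_halves {x : ℝ} (hx : 0 ≤ x) : x ^ (3 / 2 : ℝ) = √x ^ 3 := by
  rw [Real.sqrt_eq_rpow, ← Real.rpow_natCast, ← Real.rpow_mul hx]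
  norm_num

variable {d : ℕ}

theorem neg_le_lambdaMin {A : Op d} {a : ℝ} (ha : 0 ≤ a)
    (h : ∀ w, -a * ‖w‖ ^ 2 ≤ inner ℝ (A w) w) : -a ≤ lambdaMin A := by
  unfold lambdaMin
  rcases Set.eq_empty_or_nonempty
    {l : ℝ | Module.End.HasEigenvalue (A : Vec d →ₗ[ℝ] Vec d) l} with h0 | hne
  -- The infimum over an empty set of eigenvalues is `0` by convention, so `0 ≤ a` is needed.
  · rw [h0, Real.sInf_empty]; linarith
  · refine le_csInf hne fun l hl => ?_
    obtain ⟨w, hw⟩ := hl.exists_hasEigenvector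
    have h1 : A w = l • w := hw.apply_eq_smul
    have h2 := h w
    rw [h1, inner_smul_left, real_inner_self_eq_norm_sq] at h2
    have h3 : 0 < ‖w‖ ^ 2 := by have := norm_pos_iff.mpr hw.2; positivity
    exact le_of_mul_le_mul_right (by simpa using h2) h3

theorem mu_nonneg (F : Vec d → ℝ) (M : ℝ) (x : Vec d) : 0 ≤ mu F M x :=
  le_max_of_le_left (by positivity)

theorem mu_eq (F : Vec d → ℝ) {M : ℝ} (hM : 0 ≤ M) (x : Vec d) :
    mu F M x = max (√‖gradient F x‖ ^ 3) (-(lambdaMin (hess F x)) ^ 3 / √M ^ 3) := by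
  rw [mu, rpow_three_halves (norm_nonneg _), Real.rpow_neg hM, rpow_three_halves hM, div_eq_mul_inv]

theorem mu_le {F : Vec d → ℝ} {M z : ℝ} (hM : 0 < M) (hz : 0 ≤ z) {x : Vec d}
    (hg : ‖gradient F x‖ ≤ 3 * M * z ^ 2)
    (hH : ∀ w, -(4 * M * z) * ‖w‖ ^ 2 ≤ inner ℝ (hess F x w) w) :
    mu F M x ≤ 64 * √M ^ 3 * z ^ 3 := by
  have hm : 0 < √M := Real.sqrt_pos.mpr hM
  have hmm : √M ^ 2 = M := Real.sq_sqrt hM.le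
  rw [mu_eq F hM.le]
  refine max_le ?_ ?_
  · have h1 : √‖gradient F x‖ ≤ 2 * √M * z := by
      apply Real.sqrt_le_iff.mpr
      refine ⟨by positivity, hg.trans ?_⟩
      rw [mul_pow, mul_pow, hmm]
      have : 0 ≤ M * z ^ 2 := by positivity
      linarith
    calc √‖gradient F x‖ ^ 3 ≤ (2 * √M * z) ^ 3 := by gcongr
      _ = 8 * (√M ^ 3 * z ^ 3) := by ring
      _ ≤ 64 * √M ^ 3 * z ^ 3 := by
        have : 0 ≤ √M ^ 3 * z ^ 3 := by positivity
        linarith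
  · have h1 := neg_le_lambdaMin (by positivity) hH
    have h2 : -(lambdaMin (hess F x)) ^ 3 ≤ (4 * M * z) ^ 3 := by
      have h3 : (-lambdaMin (hess F x)) ^ 3 ≤ (4 * M * z) ^ 3 :=
        (Odd.pow_le_pow (by decide : Odd 3)).mpr (by linarith)
      rwa [Odd.neg_pow (by decide : Odd 3)] at h3
    rw [div_le_iff₀ (by positivity)]
    refine h2.trans (le_of_eq ?_)
    have : (√M ^ 3) ^ 2 = M ^ 3 := by
      calc (√M ^ 3) ^ 2 = (√M ^ 2) ^ 3 := by ring
        _ = M ^ 3 := by rw [hmm]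
    linear_combination (-64 * z ^ 3) * this

/-- The factor `Cm` in the penalty cancels the one in the tolerance: the curvature bound is `√(Cm L
· ε / Cm) = √(L ε)`. -/
theorem isApproxLocalMin_of_mu_le {F : Vec d → ℝ} {Cm L ε : ℝ} (hCm : 1 ≤ Cm) (hL : 0 < L)
    (hε : 0 < ε) {x : Vec d} (h : mu F (Cm * L) x ≤ (ε / Cm) ^ (3 / 2 : ℝ)) :
    IsApproxLocalMin F ε √(L * ε) x := by
  have hC0 : 0 < Cm := by linarith
  rw [mu_eq F (by positivity), rpow_three_halves (by positivity)] at h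
  have hg := (le_max_left _ _).trans h
  have hH := (le_max_right _ _).trans h
  constructor
  · have h1 : √‖gradient F x‖ ≤ √(ε / Cm) :=
      le_of_pow_le_pow_left₀ (by norm_num) (by positivity) hg
    have h2 := (Real.sqrt_le_sqrt_iff (by positivity)).mp h1
    exact h2.trans (div_le_self hε.le hCm)
  · have hm : 0 < √(Cm * L) := by positivity
    rw [div_le_iff₀ (by positivity), ← mul_pow, ← Real.sqrt_mul (by positivity)] at hH
    have e : ε / Cm * (Cm * L) = L * ε := by field_simp
    rw [e] at hH
    have h3 : (-lambdaMin (hess F x)) ^ 3 ≤ √(L * ε) ^ 3 := by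
      rwa [Odd.neg_pow (by decide : Odd 3)]
    have h4 := (Odd.pow_le_pow (by decide : Odd 3)).mp h3
    linarith

/-- Young's inequality, with `1/48` chosen so that the gradient and Hessian errors together use half
of the decrease `M ρ³ / 12`. -/
theorem sq_mul_le_cube {p ρ : ℝ} (hp : 0 ≤ p) (hρ : 0 ≤ ρ) :
    p ^ 2 * ρ ≤ ρ ^ 3 / 48 + 7 * p ^ 3 := by
  rcases le_total ρ (7 * p) with h | h
  · have h1 : p ^ 2 * ρ ≤ p ^ 2 * (7 * p) := by gcongr
    have : 0 ≤ ρ ^ 3 / 48 := by positivity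
    nlinarith
  · have h1 : (7 * p) ^ 2 * ρ ≤ ρ ^ 2 * ρ := by gcongr
    have : 0 ≤ p ^ 3 := by positivity
    have : 0 ≤ ρ ^ 3 := by positivity
    nlinarith

theorem mul_sq_le_cube {q ρ : ℝ} (hq : 0 ≤ q) (hρ : 0 ≤ ρ) :
    q * ρ ^ 2 / 2 ≤ ρ ^ 3 / 48 + 288 * q ^ 3 := by
  rcases le_total ρ (24 * q) with h | h
  · have h1 : q * ρ ^ 2 ≤ q * (24 * q) ^ 2 := by gcongr
    have : 0 ≤ ρ ^ 3 / 48 := by positivity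
    nlinarith
  · have h1 : 24 * q * ρ ^ 2 ≤ ρ * ρ ^ 2 := by gcongr
    have : 0 ≤ q ^ 3 := by positivity
    nlinarith

/-- One inexact cubic step decreases `F` by a multiple of `μ` at the new point and of the cube of
the step length, up to the errors `M p²` and `M q` of the gradient and the Hessian. -/
theorem cubic_step_decrease {F : Vec d → ℝ} (hF : ContDiff ℝ 2 F) {L M : ℝ} (hL0 : 0 ≤ L)
    (hL : ∀ x y, ‖hess F x - hess F y‖ ≤ L * ‖x - y‖) (hM : 0 < M) (hML : 6 * L ≤ M)
    {x v h : Vec d} {U : Op d} (hU : (U : Vec d →ₗ[ℝ] Vec d).IsSymmetric)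
    (hmin : ∀ w, cubicModel M v U h ≤ cubicModel M v U w) {p q : ℝ} (hp : 0 ≤ p) (hq : 0 ≤ q)
    (hpv : ‖v - gradient F x‖ ≤ M * p ^ 2) (hqU : ‖U - hess F x‖ ≤ M * q) :
    F (x + h) + mu F M (x + h) / (3072 * √M) + M / 48 * ‖h‖ ^ 3
      ≤ F x + M * (8 * p ^ 3 + 289 * q ^ 3) := by
  have hGd := differentiable_gradient hF
  have hmm : √M ^ 2 = M := Real.sq_sqrt hM.le
  have hm : 0 < √M := Real.sqrt_pos.mpr hM
  set ρ := ‖h‖ with hρdef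
  have hρ : 0 ≤ ρ := norm_nonneg h
  have hUh : ∀ w, ‖U w - hess F x w‖ ≤ M * q * ‖w‖ := fun w =>
    (U - hess F x).le_of_opNorm_le hqU w
  have descent : F (x + h) ≤ F x - M / 24 * ρ ^ 3 + M * (7 * p ^ 3 + 288 * q ^ 3) := by
    have h1 := le_quadratic_model (hF.differentiable (by norm_num)) hGd hL hL0 x
      (hess_isSymmetric hF x) h
    have h2 := cubicModel_le_of_isMin hM hmin
    have h3 : -(inner ℝ (v - gradient F x) h : ℝ) ≤ M * p ^ 2 * ρ :=
      (neg_le_abs _).trans ((abs_real_inner_le_norm _ _).trans (by gcongr))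
    have h4 : -(inner ℝ (U h - hess F x h) h : ℝ) ≤ M * q * ρ * ρ :=
      (neg_le_abs _).trans ((abs_real_inner_le_norm _ _).trans
        (mul_le_mul_of_nonneg_right (hUh h) hρ))
    rw [inner_sub_left] at h3 h4
    rw [cubicModel, ← hρdef] at h2
    rw [← hρdef] at h1
    have h5 : L * ρ ^ 3 ≤ M / 6 * ρ ^ 3 := by gcongr; linarith
    have h6 := mul_le_mul_of_nonneg_left (sq_mul_le_cube hp hρ) hM.le
    have h7 := mul_le_mul_of_nonneg_left (mul_sq_le_cube hq hρ) hM.le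
    linarith
  -- One scale for step and errors: the new gradient and curvature are of order `M z²` and `M z`.
  set z := max ρ (max p q) with hz
  have hzρ : ρ ≤ z := le_max_left _ _
  have hzp : p ≤ z := (le_max_left _ _).trans (le_max_right _ _)
  have hzq : q ≤ z := (le_max_right _ _).trans (le_max_right _ _)
  have hz0 : 0 ≤ z := hρ.trans hzρ
  have hz3 : z ^ 3 ≤ ρ ^ 3 + p ^ 3 + q ^ 3 := by
    have a1 : 0 ≤ ρ ^ 3 := by positivity
    have a2 : 0 ≤ p ^ 3 := by positivity
    have a3 : 0 ≤ q ^ 3 := by positivity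
    rcases max_choice ρ (max p q) with e | e
    · rw [hz, e]; linarith
    · rcases max_choice p q with e' | e' <;> rw [hz, e, e'] <;> linarith
  have hgrad : ‖gradient F (x + h)‖ ≤ 3 * M * z ^ 2 := by
    have h1 : ‖gradient F (x + h) - gradient F x - hess F x h‖ ≤ L * ρ ^ 2 :=
      norm_sub_linearization_le hGd hL hL0 x h
    have h2 := norm_residual_le_of_isMin hM hU hmin
    have e : gradient F (x + h) = (gradient F (x + h) - gradient F x - hess F x h)
      - (v - gradient F x) - (U h - hess F x h) + (v + U h) := by abel
    have h3 : ‖gradient F (x + h)‖ ≤ L * ρ ^ 2 + M * p ^ 2 + M * q * ρ + M / 2 * ρ ^ 2 := by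
      rw [e]
      refine (norm_add_le _ _).trans (add_le_add ?_ h2)
      refine (norm_sub_le _ _).trans (add_le_add ?_ (hUh h))
      exact (norm_sub_le _ _).trans (add_le_add h1 hpv)
    have a1 : L * ρ ^ 2 ≤ M / 6 * z ^ 2 := by gcongr; linarith
    have a2 : M * p ^ 2 ≤ M * z ^ 2 := by gcongr
    have a3 : M * q * ρ ≤ M * z * z := by gcongr
    have a4 : M / 2 * ρ ^ 2 ≤ M / 2 * z ^ 2 := by gcongr
    have a5 : 0 ≤ M * z ^ 2 := by positivity
    nlinarith
  have hhess : ∀ w, -(4 * M * z) * ‖w‖ ^ 2 ≤ inner ℝ (hess F (x + h) w) w := by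
    intro w
    have h1 := curvature_ge_of_isMin hM hU hmin w
    have h2 : (inner ℝ (U w - hess F x w) w : ℝ) ≤ M * q * ‖w‖ * ‖w‖ :=
      (le_abs_self _).trans ((abs_real_inner_le_norm _ _).trans
        (mul_le_mul_of_nonneg_right (hUh w) (norm_nonneg w)))
    have h3 : -(inner ℝ (hess F (x + h) w - hess F x w) w : ℝ) ≤ L * ρ * ‖w‖ * ‖w‖ := by
      refine (neg_le_abs _).trans ((abs_real_inner_le_norm _ _).trans
        (mul_le_mul_of_nonneg_right ?_ (norm_nonneg w)))
      refine (hess F (x + h) - hess F x).le_of_opNorm_le ?_ w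
      simpa using hL (x + h) x
    rw [inner_sub_left] at h2 h3
    have a1 : M * q * ‖w‖ * ‖w‖ ≤ M * z * ‖w‖ * ‖w‖ := by gcongr
    have a2 : L * ρ * ‖w‖ * ‖w‖ ≤ M / 6 * z * ‖w‖ * ‖w‖ := by gcongr; linarith
    have a3 : 8 / 3 * M * ρ * ‖w‖ ^ 2 ≤ 8 / 3 * M * z * ‖w‖ ^ 2 := by gcongr
    have a4 : 0 ≤ M * z * ‖w‖ ^ 2 := by positivity
    nlinarith
  have hmu := mu_le hM hz0 hgrad hhess
  -- Half of the remaining `M ρ³ / 24` pays for `μ`; `3072 = 64 * 48`.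
  have hmu2 : mu F M (x + h) / (3072 * √M) ≤ M / 48 * (ρ ^ 3 + p ^ 3 + q ^ 3) := by
    rw [div_le_iff₀ (by positivity)]
    refine hmu.trans ?_
    calc 64 * √M ^ 3 * z ^ 3 ≤ 64 * √M ^ 3 * (ρ ^ 3 + p ^ 3 + q ^ 3) := by gcongr
      _ = √M ^ 2 / 48 * (ρ ^ 3 + p ^ 3 + q ^ 3) * (3072 * √M) := by ring
      _ = _ := by rw [hmm]
  have b1 : 0 ≤ M * p ^ 3 := by positivity
  have b2 : 0 ≤ M * q ^ 3 := by positivity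
  linarith

end Step

/-! ### Extended-real expectations and conditioning. -/

section Expect

variable {α β : Type*}

theorem expect_pure (a : α) (g : α → ℝ) : expect (PMF.pure a) g = ENNReal.ofReal (g a) := by
  rw [expect, tsum_eq_single a]
  · simp
  · intro b hb; simp [hb]

theorem expect_bind_le {p : PMF α} {q : α → PMF β} {g : β → ℝ} {c : α → ℝ}
    (h : ∀ a ∈ p.support, expect (q a) g ≤ ENNReal.ofReal (c a)) :
    expect (p.bind q) g ≤ expect p c := by
  have e : expect (p.bind q) g = ∑' a, p a * expect (q a) g := by
    simp only [expect, PMF.bind_apply, ← ENNReal.tsum_mul_right, ← ENNReal.tsum_mul_left]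
    rw [ENNReal.tsum_comm]
    simp only [mul_assoc]
  rw [e]
  refine ENNReal.tsum_le_tsum fun a => ?_
  by_cases ha : p a = 0
  · simp [ha]
  · exact mul_le_mul_right (h a ((PMF.mem_support_iff _ _).mpr ha)) _

theorem expect_const_mul (p : PMF α) {c : ℝ} (hc : 0 ≤ c) (g : α → ℝ) :
    expect p (fun a => c * g a) = ENNReal.ofReal c * expect p g := by
  simp only [expect, ENNReal.ofReal_mul hc, ← ENNReal.tsum_mul_left]
  exact tsum_congr fun a => by ring

theorem expect_uniform_le [Fintype α] [Nonempty α] {g : α → ℝ} (hg : ∀ a, 0 ≤ g a) {c : ℝ}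
    (h : ∑ a, g a ≤ Fintype.card α * c) :
    expect (PMF.uniformOfFintype α) g ≤ ENNReal.ofReal c := by
  have hn : (0 : ℝ) < Fintype.card α := by exact_mod_cast Fintype.card_pos
  have e : expect (PMF.uniformOfFintype α) g
      = ENNReal.ofReal ((Fintype.card α : ℝ)⁻¹ * ∑ a, g a) := by
    rw [expect, tsum_fintype, ENNReal.ofReal_mul (by positivity), ENNReal.ofReal_inv_of_pos hn,
      ENNReal.ofReal_natCast, ENNReal.ofReal_sum_of_nonneg fun a _ => hg a, Finset.mul_sum]
    simp
  rw [e]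
  refine ENNReal.ofReal_le_ofReal ?_
  rwa [inv_mul_le_iff₀ hn]

end Expect

/-! ### Third moments of the batch errors. -/

section BatchErrors

variable {d n : ℕ} [NeZero n] {f : Fin n → Vec d → ℝ}

/-- The gradient error of a batch, as `M p²` with a bound on the third moment of `p`. -/
theorem exists_gradient_error {L₁ L₂ Cm ν : ℝ} (hL₁ : 0 < L₁) (hL₂ : 0 < L₂) (hCm : 1 ≤ Cm)
    (hν : 0 < ν) (hL : ∀ i x y, ‖gradient (f i) x - gradient (f i) y‖ ≤ L₁ * ‖x - y‖)
    (xr x : Vec d) {b : ℕ} (hb : b = ⌈4 * L₁ ^ 2 / L₂ ^ 2 * ν ^ 4 / ‖x - xr‖ ^ 2⌉₊) :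
    ∃ p : (Fin b → Fin n) → ℝ, (∀ I, 0 ≤ p I) ∧
      (∀ I, ‖semiGrad f xr x I - fullGrad f x‖ ≤ Cm * L₂ * p I ^ 2) ∧
      ∑ I, p I ^ 3 ≤ Fintype.card (Fin b → Fin n) * (2 * ‖x - xr‖ ^ 3 / (Cm * ν ^ 3)) := by
  rcases (norm_nonneg (x - xr)).eq_or_lt with h0 | hr
  -- At the reference point division by zero makes the batch empty, and the estimator is exact.
  · have : x = xr := by rw [← sub_eq_zero, ← norm_eq_zero, ← h0]
    subst this
    exact ⟨fun _ => 0, by simp, by simp [semiGrad_self], by simp⟩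
  have hC0 : 0 < Cm := by linarith
  set r := ‖x - xr‖ with hrdef
  set M := Cm * L₂ with hMdef
  have hM : 0 < M := by positivity
  have hDb : 4 * L₁ ^ 2 / L₂ ^ 2 * ν ^ 4 / r ^ 2 ≤ b := by rw [hb]; exact Nat.le_ceil _
  have hb' : (0 : ℝ) < b := lt_of_lt_of_le (by positivity) hDb
  have hvar := sum_norm_semiGrad_sub_sq_le hL (by exact_mod_cast hb' : 0 < b) xr x
  rw [← hrdef] at hvar
  set σ := √(1 / Cm) with hσ
  have hσ0 : 0 < σ := by positivity
  have hσ2 : σ ^ 2 = 1 / Cm := Real.sq_sqrt (by positivity)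
  -- `a` is the scale at which the batch size `D_g / r²` gives `E p⁴ ≤ a⁴`; the cube is then
  -- interpolated by `p³ ≤ a³ (1 + p⁴ / a⁴)`.
  set a := σ * r / ν with ha
  have ha0 : 0 < a := by positivity
  have ha4 : M ^ 2 * a ^ 4 = L₂ ^ 2 * r ^ 4 / ν ^ 4 := by
    have : M ^ 2 * a ^ 4 = M ^ 2 * (σ ^ 2) ^ 2 * r ^ 4 / ν ^ 4 := by rw [ha]; field_simp
    rw [this, hσ2, hMdef]
    field_simp
  have hQ : 2 * L₁ ^ 2 * r ^ 2 / b ≤ M ^ 2 * a ^ 4 := by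
    rw [ha4, div_le_iff₀ hb']
    calc 2 * L₁ ^ 2 * r ^ 2 ≤ 4 * L₁ ^ 2 * r ^ 2 := by gcongr; norm_num
      _ = L₂ ^ 2 * r ^ 4 / ν ^ 4 * (4 * L₁ ^ 2 / L₂ ^ 2 * ν ^ 4 / r ^ 2) := by field_simp
      _ ≤ _ := by gcongr
  set p : (Fin b → Fin n) → ℝ := fun I => √(‖semiGrad f xr x I - fullGrad f x‖ / M) with hp
  have hp2 : ∀ I, p I ^ 2 = ‖semiGrad f xr x I - fullGrad f x‖ / M := fun I =>
    Real.sq_sqrt (by positivity)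
  refine ⟨p, fun I => Real.sqrt_nonneg _, fun I => ?_, ?_⟩
  · rw [hp2, mul_div_cancel₀ _ hM.ne']
  · have h4 : ∑ I, p I ^ 4 ≤ Fintype.card (Fin b → Fin n) * a ^ 4 := by
      have e : ∀ I, p I ^ 4 = ‖semiGrad f xr x I - fullGrad f x‖ ^ 2 / M ^ 2 := fun I => by
        rw [← div_pow, ← hp2]; ring
      simp only [e]
      rw [← Finset.sum_div, div_le_iff₀ (by positivity)]
      refine (hvar.trans (mul_le_mul_of_nonneg_left hQ (Nat.cast_nonneg _))).trans (le_of_eq ?_)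
      ring
    have h3 : ∑ I, p I ^ 3 ≤ ∑ I, a ^ 3 * (1 + p I ^ 4 / a ^ 4) :=
      Finset.sum_le_sum fun I _ => cube_le_add_pow (p := 2) (Real.sqrt_nonneg _) ha0 le_rfl
    have e : ∑ I, a ^ 3 * (1 + p I ^ 4 / a ^ 4)
        = a ^ 3 * (Fintype.card (Fin b → Fin n) + (∑ I, p I ^ 4) / a ^ 4) := by
      rw [← Finset.mul_sum, Finset.sum_add_distrib, Finset.sum_div]; simp
    have h5 : (∑ I, p I ^ 4) / a ^ 4 ≤ Fintype.card (Fin b → Fin n) := by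
      rw [div_le_iff₀ (by positivity)]; exact h4
    have hσ1 : σ ≤ 1 := Real.sqrt_le_one.mpr (by rw [div_le_one hC0]; exact hCm)
    have ha3 : a ^ 3 ≤ r ^ 3 / (Cm * ν ^ 3) := by
      have e1 : a ^ 3 = σ ^ 2 * σ * r ^ 3 / ν ^ 3 := by rw [ha]; field_simp
      rw [e1, hσ2]
      calc 1 / Cm * σ * r ^ 3 / ν ^ 3 ≤ 1 / Cm * 1 * r ^ 3 / ν ^ 3 := by gcongr
        _ = _ := by field_simp
    have h6 : 0 ≤ (∑ I, p I ^ 4) / a ^ 4 :=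
      div_nonneg (Finset.sum_nonneg fun I _ => by positivity) (by positivity)
    refine (h3.trans e.le).trans ?_
    generalize (∑ I, p I ^ 4) / a ^ 4 = t at h5 h6 ⊢
    generalize (Fintype.card (Fin b → Fin n) : ℝ) = N at h5 h6 ⊢
    calc a ^ 3 * (N + t) ≤ r ^ 3 / (Cm * ν ^ 3) * (N + N) :=
          mul_le_mul ha3 (by linarith) (by linarith) (by positivity)
      _ = _ := by ring

/-- The Hessian error of a batch, as `M q` with a bound on the third moment of `q`. -/
theorem exists_hessian_error {L₂ Cm Ch θ n' : ℝ} (hf : ∀ i, ContDiff ℝ 2 (f i)) (hL₂ : 0 < L₂)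
    (hCm : 1 ≤ Cm) (hCh : 0 < Ch) (hn' : 0 < n') (hθ : 0 < θ) (hθ3 : θ ^ 3 = Ch * n')
    (hL : ∀ i x y, ‖hess (f i) x - hess (f i) y‖ ≤ L₂ * ‖x - y‖) (hd : 2 ≤ d)
    (xr x : Vec d) {b : ℕ} (hb : Real.log d * θ ^ 2 ≤ b) :
    ∃ q : (Fin b → Fin n) → ℝ, (∀ I, 0 ≤ q I) ∧
      (∀ I, ‖semiHess f xr x I - fullHess f x‖ ≤ Cm * L₂ * q I) ∧
      ∑ I, q I ^ 3 ≤ Fintype.card (Fin b → Fin n) * (2000 * ‖x - xr‖ ^ 3 / (Cm * Ch * n')) := by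
  have hC0 : 0 < Cm := by linarith
  have hM : 0 < Cm * L₂ := by positivity
  refine ⟨fun I => ‖semiHess f xr x I - fullHess f x‖ / (Cm * L₂), fun I => by positivity,
    fun I => by rw [mul_div_cancel₀ _ hM.ne'], ?_⟩
  have h := sum_norm_semiHess_sub_cube_le hf hL₂ hL hd hθ hb xr x
  simp only [div_pow]
  rw [← Finset.sum_div, div_le_iff₀ (by positivity)]
  refine h.trans ?_
  rw [mul_assoc (Fintype.card (Fin b → Fin n) : ℝ), hθ3]
  gcongr
  rw [div_le_iff₀ (by positivity)]
  have e : 2000 * ‖x - xr‖ ^ 3 / (Cm * Ch * n') * (Cm * L₂) ^ 3 * (Ch * n')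
      = 2000 * L₂ ^ 3 * ‖x - xr‖ ^ 3 * Cm ^ 2 := by field_simp
  rw [e]
  exact le_mul_of_one_le_right (by positivity) (one_le_pow₀ hCm)

end BatchErrors

/-! ### The Lyapunov function. -/

section Potential

/-- Convexity of the cube with weights `T / (1 + T)` and `1 / (1 + T)`; the difference of the two
sides factors explicitly. -/
theorem add_cube_le {r ρ T : ℝ} (hr : 0 ≤ r) (hρ : 0 ≤ ρ) (hT : 0 < T) :
    (r + ρ) ^ 3 ≤ (1 + 1 / T) ^ 2 * r ^ 3 + (1 + T) ^ 2 * ρ ^ 3 := by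
  have e : (1 + 1 / T) ^ 2 * r ^ 3 + (1 + T) ^ 2 * ρ ^ 3 - (r + ρ) ^ 3
      = (r - T * ρ) ^ 2 * ((2 * T ^ 2 + T) * r + (T ^ 2 + 2 * T) * (T * ρ)) / T ^ 3 := by
    field_simp
    ring
  have : 0 ≤ (r - T * ρ) ^ 2 * ((2 * T ^ 2 + T) * r + (T ^ 2 + 2 * T) * (T * ρ)) / T ^ 3 := by
    positivity
  linarith

variable {d : ℕ}

/-- `F` above its lower bound `lb`, plus the weighted values of `μ` at all past iterates. -/
def potential (F : Vec d → ℝ) (M lb : ℝ) (st : RunState d) : ℝ :=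
  F st.pt - lb + (st.hist.map (mu F M)).sum / (3072 * √M)

theorem hist_sum_nonneg (F : Vec d → ℝ) (M : ℝ) (l : List (Vec d)) :
    0 ≤ (l.map (mu F M)).sum :=
  List.sum_nonneg fun y hy => by
    obtain ⟨x, _, rfl⟩ := List.mem_map.mp hy
    exact mu_nonneg F M x

theorem potential_nonneg {F : Vec d → ℝ} {M lb : ℝ} (hlb : ∀ x, lb ≤ F x) (st : RunState d) :
    0 ≤ potential F M lb st :=
  add_nonneg (sub_nonneg.mpr (hlb _)) (div_nonneg (hist_sum_nonneg F M _) (by positivity))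

/-- The change of the Lyapunov function in one inexact cubic step. -/
theorem potential_move_le {F : Vec d → ℝ} (hF : ContDiff ℝ 2 F) {L M lb : ℝ} (hL0 : 0 ≤ L)
    (hL : ∀ x y, ‖hess F x - hess F y‖ ≤ L * ‖x - y‖) (hM : 0 < M) (hML : 6 * L ≤ M)
    {st : RunState d} {v h xr : Vec d} {U : Op d} (hU : (U : Vec d →ₗ[ℝ] Vec d).IsSymmetric)
    (hmin : ∀ w, cubicModel M v U h ≤ cubicModel M v U w) {p q : ℝ} (hp : 0 ≤ p) (hq : 0 ≤ q)
    (hpv : ‖v - gradient F st.pt‖ ≤ M * p ^ 2) (hqU : ‖U - hess F st.pt‖ ≤ M * q)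
    {a T : ℝ} (ha : 0 ≤ a) (hT : 0 < T) (haT : a * (1 + T) ^ 2 ≤ M / 48) (k : ℕ) :
    potential F M lb (st.move h k) + a * ‖(st.move h k).pt - xr‖ ^ 3
      ≤ potential F M lb st + a * (1 + 1 / T) ^ 2 * ‖st.pt - xr‖ ^ 3
        + M * (8 * p ^ 3 + 289 * q ^ 3) := by
  have h1 := cubic_step_decrease hF hL0 hL hM hML hU hmin hp hq hpv hqU
  have h2 : ‖st.pt + h - xr‖ ^ 3 ≤ (‖st.pt - xr‖ + ‖h‖) ^ 3 := by
    have : ‖st.pt + h - xr‖ ≤ ‖st.pt - xr‖ + ‖h‖ := by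
      rw [add_sub_right_comm]; exact norm_add_le _ _
    gcongr
  have h3 := mul_le_mul_of_nonneg_left (h2.trans (add_cube_le (norm_nonneg _) (norm_nonneg h) hT)) ha
  have h4 := mul_le_mul_of_nonneg_right haT (show 0 ≤ ‖h‖ ^ 3 by positivity)
  simp only [potential, RunState.move, List.map_cons, List.sum_cons, add_div]
  linarith

end Potential

/-! ### Counting along a run, and the Lyapunov function within an epoch. -/

section Run

variable {d n : ℕ} [NeZero n] {f : Fin n → Vec d → ℝ} {argm : ℝ → Vec d → Op d → Vec d}

theorem support_innerLoop {Dg Dh M : ℝ} {xr : Vec d} {st : RunState d} (k : ℕ) :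
    ∀ st' ∈ (innerLoop f argm Dg Dh (fun _ => M) xr st k).support,
      st'.hist.length = st.hist.length + k ∧ st'.evals = st.evals + k * (2 * ⌈Dh⌉₊) := by
  induction k with
  | zero =>
    intro st' h
    rw [innerLoop, PMF.mem_support_pure_iff] at h
    simp [h]
  | succ k ih =>
    intro st' h
    rw [innerLoop, PMF.mem_support_bind_iff] at h
    obtain ⟨st₁, h₁, h⟩ := h
    rw [innerStep, PMF.mem_support_bind_iff] at h
    obtain ⟨Ig, -, h⟩ := h
    rw [PMF.mem_support_bind_iff] at h
    obtain ⟨Ih, -, h⟩ := h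
    rw [PMF.mem_support_pure_iff] at h
    obtain ⟨a, b⟩ := ih st₁ h₁
    subst h
    simp only [RunState.move, List.length_cons, a, b]
    constructor <;> ring

theorem support_epochs {Dg Dh M : ℝ} {T : ℕ} (hT : 0 < T) {x₀ : Vec d} (s : ℕ) :
    ∀ st ∈ (epochs f argm Dg Dh (fun _ _ => M) T x₀ s).support,
      st.hist.length = s * T ∧ st.evals = s * (n + (T - 1) * (2 * ⌈Dh⌉₊)) := by
  induction s with
  | zero =>
    intro st h
    rw [epochs, PMF.mem_support_pure_iff] at h
    simp [h]
  | succ s ih =>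
    intro st h
    rw [epochs, PMF.mem_support_bind_iff] at h
    obtain ⟨st₁, h₁, h⟩ := h
    obtain ⟨a, b⟩ := ih st₁ h₁
    obtain ⟨a', b'⟩ := support_innerLoop (T - 1) st h
    simp only [RunState.move, List.length_cons] at a' b'
    refine ⟨?_, ?_⟩
    · rw [a', a, add_assoc, Nat.add_sub_cancel' hT]; ring
    · rw [b', b]; ring

theorem support_liteSVRC {Dg Dh M : ℝ} {S T : ℕ} (hT : 0 < T) {x₀ : Vec d} :
    ∀ o ∈ (liteSVRC f argm Dg Dh (fun _ _ => M) S T x₀).support,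
      o.2 = S * (n + (T - 1) * (2 * ⌈Dh⌉₊)) := by
  intro o h
  rw [liteSVRC, PMF.mem_support_bind_iff] at h
  obtain ⟨st, hst, h⟩ := h
  rw [← (support_epochs hT S st hst).2]
  unfold chooseOutput at h
  split_ifs at h with h0
  · rw [PMF.mem_support_pure_iff] at h; rw [h]
  · rw [PMF.mem_support_map_iff] at h
    obtain ⟨i, -, rfl⟩ := h
    rfl

theorem expect_chooseOutput_le {g : Vec d → ℝ} (hg : ∀ x, 0 ≤ g x) {st : RunState d}
    (h : st.hist.length ≠ 0) :
    expect (chooseOutput st) (fun o => g o.1)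
      ≤ ENNReal.ofReal ((st.hist.map g).sum / st.hist.length) := by
  have : NeZero st.hist.length := ⟨h⟩
  rw [chooseOutput, dif_neg h, PMF.map]
  refine (expect_bind_le (c := fun i => g (st.hist.get i)) fun i _ => ?_).trans ?_
  · rw [Function.comp_apply, expect_pure]
  · refine expect_uniform_le (fun i => hg _) ?_
    have : (0 : ℝ) < st.hist.length := by exact_mod_cast Nat.pos_of_ne_zero h
    rw [Fintype.card_fin, mul_div_cancel₀ _ this.ne', ← Fin.sum_univ_fun_getElem]
    rfl

/-- The weights of `‖x - x̂‖³` in the Lyapunov function, by the number of remaining steps. -/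
def cubeWeight (δ T : ℝ) (j : ℕ) : ℝ := δ * T * (((1 + 1 / T) ^ 2) ^ j - 1)

/-- The weight with one more step left must cover both the growth of `‖x - x̂‖³` in a step and the
sampling error `δ ‖x - x̂‖³`. -/
theorem cubeWeight_succ {δ T : ℝ} (hδ : 0 ≤ δ) (hT : 0 < T) (j : ℕ) :
    cubeWeight δ T j * (1 + 1 / T) ^ 2 + δ ≤ cubeWeight δ T (j + 1) := by
  have h : 1 ≤ T * ((1 + 1 / T) ^ 2 - 1) := by
    have : T * ((1 + 1 / T) ^ 2 - 1) = 2 + 1 / T := by field_simp; ring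
    rw [this]
    have : 0 < 1 / T := by positivity
    linarith
  have h2 := mul_le_mul_of_nonneg_left h hδ
  rw [cubeWeight, cubeWeight, pow_succ _ j]
  linarith

theorem cubeWeight_nonneg {δ T : ℝ} (hδ : 0 ≤ δ) (hT : 0 < T) (j : ℕ) :
    0 ≤ cubeWeight δ T j := by
  have h1 : (1 : ℝ) ≤ 1 + 1 / T := by
    have : 0 < 1 / T := by positivity
    linarith
  have h2 : (1 : ℝ) ≤ ((1 + 1 / T) ^ 2) ^ j := one_le_pow₀ (one_le_pow₀ h1)
  exact mul_nonneg (by positivity) (by linarith)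

/-- `(1 + 1/T)^{2T} ≤ e² ≤ 9`, so the weights grow only by a constant factor over an epoch of length
`T`. -/
theorem cubeWeight_le {δ : ℝ} {T : ℕ} (hδ : 0 ≤ δ) (hT : 0 < T) {j : ℕ} (hj : j ≤ T) :
    cubeWeight δ T j ≤ 8 * (δ * T) := by
  have hT' : (0 : ℝ) < T := by exact_mod_cast hT
  have h1 : (1 : ℝ) ≤ 1 + 1 / T := by
    have : (0 : ℝ) < 1 / T := by positivity
    linarith
  have h2 : ((1 + 1 / (T : ℝ)) ^ 2) ^ j ≤ 9 := by
    calc ((1 + 1 / (T : ℝ)) ^ 2) ^ j ≤ ((1 + 1 / (T : ℝ)) ^ 2) ^ T :=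
          pow_le_pow_right₀ (one_le_pow₀ h1) hj
      _ = ((1 + 1 / (T : ℝ)) ^ T) ^ 2 := by rw [← pow_mul, ← pow_mul, mul_comm]
      _ ≤ (Real.exp (1 / T) ^ T) ^ 2 := by
        have := Real.add_one_le_exp (1 / (T : ℝ))
        gcongr
        linarith
      _ = Real.exp 1 ^ 2 := by rw [← Real.exp_nat_mul, mul_one_div_cancel hT'.ne']
      _ ≤ 3 ^ 2 := by
        have := Real.exp_one_lt_d9
        have h3 := Real.exp_pos 1
        gcongr
        linarith
      _ = 9 := by norm_num
  have h3 : 0 ≤ δ * T := by positivity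
  rw [cubeWeight]
  nlinarith

variable {L M lb Dg Dh δ : ℝ}

theorem expect_innerStep_le (hf : ∀ i, ContDiff ℝ 2 (f i)) (hL0 : 0 ≤ L)
    (hL : ∀ i x y, ‖hess (f i) x - hess (f i) y‖ ≤ L * ‖x - y‖) (hM : 0 < M) (hML : 6 * L ≤ M)
    (hlb : ∀ x, lb ≤ objective f x) (hargm : IsCubicArgmin argm) {xr : Vec d} {st : RunState d}
    {p : (Fin ⌈Dg / ‖st.pt - xr‖ ^ 2⌉₊ → Fin n) → ℝ} {q : (Fin ⌈Dh⌉₊ → Fin n) → ℝ}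
    (hp : ∀ I, 0 ≤ p I) (hq : ∀ I, 0 ≤ q I)
    (hpv : ∀ I, ‖semiGrad f xr st.pt I - fullGrad f st.pt‖ ≤ M * p I ^ 2)
    (hqU : ∀ I, ‖semiHess f xr st.pt I - fullHess f st.pt‖ ≤ M * q I)
    {α β : ℝ} (hα : ∑ I, p I ^ 3 ≤ Fintype.card (Fin ⌈Dg / ‖st.pt - xr‖ ^ 2⌉₊ → Fin n) * α)
    (hβ : ∑ I, q I ^ 3 ≤ Fintype.card (Fin ⌈Dh⌉₊ → Fin n) * β)
    {a a' T : ℝ} (ha : 0 ≤ a) (hT : 0 < T) (haT : a * (1 + T) ^ 2 ≤ M / 48)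
    (hαβ : M * (8 * α + 289 * β) ≤ δ * ‖st.pt - xr‖ ^ 3)
    (haa : a * (1 + 1 / T) ^ 2 + δ ≤ a') :
    expect (innerStep f argm Dg Dh M xr st)
        (fun s => potential (objective f) M lb s + a * ‖s.pt - xr‖ ^ 3)
      ≤ ENNReal.ofReal (potential (objective f) M lb st + a' * ‖st.pt - xr‖ ^ 3) := by
  set base := potential (objective f) M lb st + a * (1 + 1 / T) ^ 2 * ‖st.pt - xr‖ ^ 3 with hbase
  have hbase0 : 0 ≤ base := add_nonneg (potential_nonneg hlb st) (by positivity)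
  have hLF : ∀ x y, ‖hess (objective f) x - hess (objective f) y‖ ≤ L * ‖x - y‖ := by
    rw [hess_objective hf]; exact norm_fullHess_sub_le hL
  have hpt : ∀ Ig Ih, potential (objective f) M lb (st.move (argm M (semiGrad f xr st.pt Ig)
      (semiHess f xr st.pt Ih)) (2 * ⌈Dh⌉₊)) + a * ‖(st.move (argm M (semiGrad f xr st.pt Ig)
      (semiHess f xr st.pt Ih)) (2 * ⌈Dh⌉₊)).pt - xr‖ ^ 3
      ≤ (base + M * (8 * p Ig ^ 3)) + M * 289 * q Ih ^ 3 := by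
    intro Ig Ih
    have hU := semiHess_isSymmetric hf xr st.pt Ih
    have := potential_move_le (lb := lb) (xr := xr) (contDiff_objective hf) hL0 hLF hM hML hU
      (hargm M (semiGrad f xr st.pt Ig) _ hM hU) (hp Ig) (hq Ih)
      (by rw [gradient_objective hf]; exact hpv Ig) (by rw [hess_objective hf]; exact hqU Ih)
      ha hT haT (2 * ⌈Dh⌉₊)
    linarith
  unfold innerStep sampleBatch
  refine (expect_bind_le (c := fun Ig => (base + M * 289 * β) + M * 8 * p Ig ^ 3)
    fun Ig _ => ?_).trans ?_
  · refine (expect_bind_le (c := fun Ih => (base + M * (8 * p Ig ^ 3)) + M * 289 * q Ih ^ 3)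
      fun Ih _ => ?_).trans ?_
    · rw [expect_pure]
      exact ENNReal.ofReal_le_ofReal (hpt Ig Ih)
    · have hp3 := pow_nonneg (hp Ig) 3
      refine expect_uniform_le (fun Ih => ?_) ?_
      · have hq3 := pow_nonneg (hq Ih) 3
        positivity
      · rw [Finset.sum_add_distrib, ← Finset.mul_sum, Finset.sum_const, nsmul_eq_mul,
          Finset.card_univ]
        have := mul_le_mul_of_nonneg_left hβ (show 0 ≤ M * 289 by positivity)
        linarith
  · have hβ0 : 0 ≤ β := by
      have h1 : 0 ≤ ∑ I, q I ^ 3 := Finset.sum_nonneg fun I _ => pow_nonneg (hq I) 3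
      have h2 : (0 : ℝ) < Fintype.card (Fin ⌈Dh⌉₊ → Fin n) := by exact_mod_cast Fintype.card_pos
      exact nonneg_of_mul_nonneg_right (h1.trans hβ) h2
    refine (expect_uniform_le (c := base + M * 289 * β + M * 8 * α) (fun Ig => ?_) ?_).trans ?_
    · have hp3 := pow_nonneg (hp Ig) 3
      positivity
    · rw [Finset.sum_add_distrib, ← Finset.mul_sum, Finset.sum_const, nsmul_eq_mul,
        Finset.card_univ]
      have := mul_le_mul_of_nonneg_left hα (show 0 ≤ M * 8 by positivity)
      linarith
    · refine ENNReal.ofReal_le_ofReal ?_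
      have := mul_le_mul_of_nonneg_right haa (show 0 ≤ ‖st.pt - xr‖ ^ 3 by positivity)
      linarith

/-- Conditioning on the state before the last step raises the weight index by one, so the induction
on `k` generalizes `j`. -/
theorem expect_innerLoop_le {a : ℕ → ℝ} {xr : Vec d} {N : ℕ}
    (hstep : ∀ j < N, ∀ st, expect (innerStep f argm Dg Dh M xr st)
        (fun s => potential (objective f) M lb s + a j * ‖s.pt - xr‖ ^ 3)
      ≤ ENNReal.ofReal (potential (objective f) M lb st + a (j + 1) * ‖st.pt - xr‖ ^ 3))
    (st : RunState d) (k j : ℕ) (hjk : j + k ≤ N) :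
    expect (innerLoop f argm Dg Dh (fun _ => M) xr st k)
        (fun s => potential (objective f) M lb s + a j * ‖s.pt - xr‖ ^ 3)
      ≤ ENNReal.ofReal (potential (objective f) M lb st + a (j + k) * ‖st.pt - xr‖ ^ 3) := by
  induction k generalizing j with
  | zero => rw [innerLoop, expect_pure]; rfl
  | succ k ih =>
    rw [innerLoop]
    refine (expect_bind_le fun s _ => hstep j (by omega) s).trans
      ((ih (j + 1) (by omega)).trans (le_of_eq ?_))
    rw [add_right_comm, add_assoc]

end Run

/-! ### From one epoch to the whole run. -/

section Convergence

variable {d n : ℕ} [NeZero n] {f : Fin n → Vec d → ℝ} {argm : ℝ → Vec d → Op d → Vec d}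
  {L M lb Dg Dh δ : ℝ}

theorem expect_epoch_le (hf : ∀ i, ContDiff ℝ 2 (f i)) (hL0 : 0 ≤ L)
    (hL : ∀ i x y, ‖hess (f i) x - hess (f i) y‖ ≤ L * ‖x - y‖) (hM : 0 < M) (hML : 6 * L ≤ M)
    (hlb : ∀ x, lb ≤ objective f x) (hargm : IsCubicArgmin argm) {T : ℕ} (hT : 0 < T)
    (hδ : 0 ≤ δ) (hδT : 8 * (δ * T) * (1 + T) ^ 2 ≤ M / 48)
    (herr : ∀ xr x : Vec d, ∃ (p : (Fin ⌈Dg / ‖x - xr‖ ^ 2⌉₊ → Fin n) → ℝ)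
      (q : (Fin ⌈Dh⌉₊ → Fin n) → ℝ) (α β : ℝ), (∀ I, 0 ≤ p I) ∧ (∀ I, 0 ≤ q I) ∧
      (∀ I, ‖semiGrad f xr x I - fullGrad f x‖ ≤ M * p I ^ 2) ∧
      (∀ I, ‖semiHess f xr x I - fullHess f x‖ ≤ M * q I) ∧
      ∑ I, p I ^ 3 ≤ Fintype.card (Fin ⌈Dg / ‖x - xr‖ ^ 2⌉₊ → Fin n) * α ∧
      ∑ I, q I ^ 3 ≤ Fintype.card (Fin ⌈Dh⌉₊ → Fin n) * β ∧
      M * (8 * α + 289 * β) ≤ δ * ‖x - xr‖ ^ 3) (st : RunState d) :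
    expect (epoch f argm Dg Dh (fun _ => M) T st) (potential (objective f) M lb)
      ≤ ENNReal.ofReal (potential (objective f) M lb st) := by
  have hT' : (0 : ℝ) < T := by exact_mod_cast hT
  have hw : ∀ j ≤ T, cubeWeight δ T j * (1 + T) ^ 2 ≤ M / 48 := fun j hj =>
    (mul_le_mul_of_nonneg_right (cubeWeight_le hδ hT hj) (by positivity)).trans hδT
  have hLF : ∀ x y, ‖hess (objective f) x - hess (objective f) y‖ ≤ L * ‖x - y‖ := by
    rw [hess_objective hf]; exact norm_fullHess_sub_le hL
  have hloop := expect_innerLoop_le (f := f) (argm := argm) (Dg := Dg) (Dh := Dh) (M := M)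
    (lb := lb) (a := cubeWeight δ T) (xr := st.pt) (N := T) (fun j hj s => by
      obtain ⟨p, q, α, β, hp, hq, hpv, hqU, hα, hβ, hαβ⟩ := herr st.pt s.pt
      exact expect_innerStep_le hf hL0 hL hM hML hlb hargm hp hq hpv hqU hα hβ
        (cubeWeight_nonneg hδ hT' j) hT' (hw j hj.le) hαβ (cubeWeight_succ hδ hT' j))
    (st.move (argm M (fullGrad f st.pt) (fullHess f st.pt)) n) (T - 1) 0 (by omega)
  -- The distance term vanishes at the end of the epoch. The exact first step, taken from distance
  -- `0` with `p = q = 0`, creates the initial one of weight index `T - 1`.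
  have h0 : cubeWeight δ T 0 = 0 := by simp [cubeWeight]
  simp only [h0, zero_mul, add_zero, zero_add] at hloop
  refine hloop.trans (ENNReal.ofReal_le_ofReal ?_)
  have hU : (fullHess f st.pt : Vec d →ₗ[ℝ] Vec d).IsSymmetric := by
    rw [← hess_objective hf]; exact hess_isSymmetric (contDiff_objective hf) _
  have := potential_move_le (lb := lb) (st := st) (xr := st.pt) (contDiff_objective hf) hL0 hLF hM
    hML hU (hargm M (fullGrad f st.pt) _ hM hU) le_rfl le_rfl (by rw [gradient_objective hf]; simp)
    (by rw [hess_objective hf]; simp) (cubeWeight_nonneg hδ hT' (T - 1)) hT'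
    (hw (T - 1) (by omega)) n
  simpa using this

theorem expect_epochs_le {T : ℕ} (x₀ : Vec d)
    (hepoch : ∀ st, expect (epoch f argm Dg Dh (fun _ => M) T st) (potential (objective f) M lb)
      ≤ ENNReal.ofReal (potential (objective f) M lb st)) (S : ℕ) :
    expect (epochs f argm Dg Dh (fun _ _ => M) T x₀ S) (potential (objective f) M lb)
      ≤ ENNReal.ofReal (objective f x₀ - lb) := by
  induction S with
  | zero => rw [epochs, expect_pure]; simp [potential]
  | succ S ih =>
    rw [epochs]
    exact (expect_bind_le fun s _ => hepoch s).trans ih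

theorem expect_liteSVRC_le (hM : 0 < M) (hlb : ∀ x, lb ≤ objective f x) {S T : ℕ} (hS : 0 < S)
    (hT : 0 < T) (x₀ : Vec d)
    (hepoch : ∀ st, expect (epoch f argm Dg Dh (fun _ => M) T st) (potential (objective f) M lb)
      ≤ ENNReal.ofReal (potential (objective f) M lb st)) :
    expect (liteSVRC f argm Dg Dh (fun _ _ => M) S T x₀) (fun o => mu (objective f) M o.1)
      ≤ ENNReal.ofReal (3072 * √M / (S * T) * (objective f x₀ - lb)) := by
  have hST : (0 : ℝ) < S * T := by
    have : (0 : ℝ) < S := by exact_mod_cast hS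
    have : (0 : ℝ) < T := by exact_mod_cast hT
    positivity
  have hm : 0 < √M := Real.sqrt_pos.mpr hM
  refine (expect_bind_le
    (c := fun st => 3072 * √M / (S * T) * potential (objective f) M lb st) fun st hst => ?_).trans ?_
  · have hlen := (support_epochs hT S st hst).1
    have hlen0 : st.hist.length ≠ 0 := by rw [hlen]; positivity
    refine (expect_chooseOutput_le (fun x => mu_nonneg (objective f) M x) hlen0).trans
      (ENNReal.ofReal_le_ofReal ?_)
    rw [hlen, Nat.cast_mul, potential, mul_add]
    have h1 : 0 ≤ 3072 * √M / (S * T) * (objective f st.pt - lb) :=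
      mul_nonneg (by positivity) (sub_nonneg.mpr (hlb _))
    have h2 : 3072 * √M / (S * T) * ((st.hist.map (mu (objective f) M)).sum / (3072 * √M))
        = (st.hist.map (mu (objective f) M)).sum / (S * T) := by
      field_simp
    rw [h2]
    linarith
  · rw [expect_const_mul _ (by positivity), ENNReal.ofReal_mul (by positivity)]
    gcongr
    exact expect_epochs_le x₀ hepoch S

end Convergence

end LiteSVRC

end

/-! ### The choice of constants. -/

open LiteSVRC
theorem corollary1 (Ch : ℝ) (hCh : 0 < Ch) :
    ∃ C₀ : ℝ, 2 < C₀ ∧ ∀ Cm : ℝ, C₀ ≤ Cm → ∃ Cs K : ℝ, 0 < Cs ∧ 0 < K ∧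
      ∀ (d n : ℕ) [NeZero n] (f : Fin n → Vec d → ℝ) (L₁ L₂ : ℝ) (x₀ : Vec d)
        (argm : ℝ → Vec d → Op d → Vec d) (ε Dg Dh : ℝ) (S T : ℕ),
        10 < n →
        0 < L₁ →
        0 < L₂ →
        (∀ i, ContDiff ℝ 2 (f i)) →
        (∀ i x y, ‖gradient (f i) x - gradient (f i) y‖ ≤ L₁ * ‖x - y‖) →
        (∀ i x y, ‖hess (f i) x - hess (f i) y‖ ≤ L₂ * ‖x - y‖) →
        BddBelow (Set.range (objective f)) →
        IsCubicArgmin argm →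
        0 < ε →
        Dg = 4 * L₁ ^ 2 / L₂ ^ 2 * (n : ℝ) ^ (4 / 3 : ℝ) →
        Dh = Real.log d * (Ch * n) ^ (2 / 3 : ℝ) →
        25 * Real.log d < Dh →
        |(T : ℝ) - (n : ℝ) ^ (1 / 3 : ℝ)| < 1 →
        S = ⌊Cs * (√L₂ * gap f x₀) / (ε ^ (3 / 2 : ℝ) * (n : ℝ) ^ (1 / 3 : ℝ))⌋₊ + 1 →
        expect (liteSVRC f argm Dg Dh (fun _ _ => Cm * L₂) S T x₀)
            (fun o => mu (objective f) (Cm * L₂) o.1) ≤ ENNReal.ofReal ((ε / Cm) ^ (3 / 2 : ℝ)) ∧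
        (∀ x, mu (objective f) (Cm * L₂) x ≤ (ε / Cm) ^ (3 / 2 : ℝ) →
          IsApproxLocalMin (objective f) ε √(L₂ * ε) x) ∧
        ∀ o ∈ (liteSVRC f argm Dg Dh (fun _ _ => Cm * L₂) S T x₀).support,
          (o.2 : ℝ) ≤ K * Real.log d *
            (n + gap f x₀ * √L₂ / ε ^ (3 / 2 : ℝ) * (n : ℝ) ^ (2 / 3 : ℝ)) := by
  -- The two summands make `16 / Cm` and `578000 / (Cm * Ch)`, the relative gradient and Hessian
  -- errors, each at most `1 / 4608`.
  refine ⟨80000 + 3000000000 / Ch, ?_, fun Cm hCm => ?_⟩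
  · have : 0 < 3000000000 / Ch := by positivity
    linarith
  have hCm1 : 80000 ≤ Cm := by
    have : 0 < 3000000000 / Ch := by positivity
    linarith
  have hCm2 : 3000000000 / Ch ≤ Cm := by linarith
  have hC0 : 0 < Cm := by linarith
  -- `Cs` is `2 * 3072 * √Cm * Cm^{3/2}`, the `2` coming from `T ≥ n^{1/3} / 2`. `K` is the cost of
  -- an epoch in units of `n log d`, times `Cs`.
  refine ⟨6144 * Cm ^ 2, (2 + 4 * (Ch ^ (1 / 3 : ℝ)) ^ 2) * (6144 * Cm ^ 2), by positivity,
    by positivity, ?_⟩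
  intro d n _ f L₁ L₂ x₀ argm ε Dg Dh S T hn hL₁ hL₂ hf hgrad hhess hbdd hargm hε hDg hDh hDh25 hT hS
  have hn0 : (0 : ℝ) < n := by positivity
  set ν : ℝ := (n : ℝ) ^ (1 / 3 : ℝ) with hν
  have hν0 : 0 < ν := by positivity
  have hν3 : ν ^ 3 = n := by
    rw [hν, ← Real.rpow_natCast, ← Real.rpow_mul hn0.le]; norm_num
  have hν2 : (n : ℝ) ^ (2 / 3 : ℝ) = ν ^ 2 := by
    rw [hν, ← Real.rpow_natCast, ← Real.rpow_mul hn0.le]; norm_num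
  have hν4 : (n : ℝ) ^ (4 / 3 : ℝ) = ν ^ 4 := by
    rw [hν, ← Real.rpow_natCast, ← Real.rpow_mul hn0.le]; norm_num
  have hν_ge : 2 ≤ ν := by
    by_contra hlt
    have h1 : ν ^ 3 ≤ 2 ^ 3 := by gcongr; exact (not_le.mp hlt).le
    have h2 : (10 : ℝ) < n := by exact_mod_cast hn
    rw [hν3] at h1
    linarith
  set κ : ℝ := Ch ^ (1 / 3 : ℝ) with hκ
  have hκ0 : 0 < κ := by positivity
  have hκ3 : κ ^ 3 = Ch := by
    rw [hκ, ← Real.rpow_natCast, ← Real.rpow_mul hCh.le]; norm_num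
  have hκν : (Ch * n) ^ (2 / 3 : ℝ) = (κ * ν) ^ 2 := by
    rw [hκ, hν, ← Real.mul_rpow hCh.le hn0.le, ← Real.rpow_natCast, ← Real.rpow_mul (by positivity)]
    norm_num
  rw [hκν] at hDh
  rw [hν4] at hDg
  rw [hν2]
  have hd : 2 ≤ d := by
    by_contra hlt
    have : d = 0 ∨ d = 1 := by omega
    -- In both cases `log d = 0`, and the strict inequality `25 log d < D_h` would read `0 < 0`.
    have hlog : Real.log d = 0 := by rcases this with h | h <;> simp [h]
    rw [hDh, hlog] at hDh25
    simp at hDh25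
  have hlog : 2 / 3 ≤ Real.log d := by
    have h1 := Real.log_two_gt_d9
    have h2 : Real.log 2 ≤ Real.log d := Real.log_le_log (by norm_num) (by exact_mod_cast hd)
    linarith
  obtain ⟨hT1, hT2⟩ := abs_lt.mp hT
  have hTν : ν ≤ 2 * T := by linarith
  have hT0' : (0 : ℝ) < T := by linarith
  have hT0 : 0 < T := by exact_mod_cast hT0'
  have hlb : ∀ x, (⨅ x, objective f x) ≤ objective f x := fun x => ciInf_le hbdd x
  have hgap : 0 ≤ gap f x₀ := sub_nonneg.mpr (hlb x₀)
  have hM : 0 < Cm * L₂ := by positivity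
  have hepoch : ∀ st, expect (epoch f argm Dg Dh (fun _ => Cm * L₂) T st)
      (potential (objective f) (Cm * L₂) (⨅ x, objective f x))
      ≤ ENNReal.ofReal (potential (objective f) (Cm * L₂) (⨅ x, objective f x) st) := by
    -- `T (1 + T)² ≤ 6 n` turns the weight condition into `48 δ n ≤ M / 48`, hence `2304 = 48²`.
    refine expect_epoch_le (δ := Cm * L₂ / (2304 * n)) hf hL₂.le hhess hM
      (mul_le_mul_of_nonneg_right (by linarith) hL₂.le) hlb hargm hT0 (by positivity) ?_ ?_
    · have h1 : (T : ℝ) * (1 + T) ^ 2 ≤ 6 * n := by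
        rw [← hν3]
        have h2 : (T : ℝ) ≤ 3 / 2 * ν := by linarith
        have h3 : 1 + (T : ℝ) ≤ 2 * ν := by linarith
        calc (T : ℝ) * (1 + T) ^ 2 ≤ 3 / 2 * ν * (2 * ν) ^ 2 := by gcongr
          _ = 6 * ν ^ 3 := by ring
      calc 8 * (Cm * L₂ / (2304 * n) * T) * (1 + T) ^ 2
          = Cm * L₂ / (288 * n) * (T * (1 + T) ^ 2) := by ring
        _ ≤ Cm * L₂ / (288 * n) * (6 * n) := by gcongr
        _ = Cm * L₂ / 48 := by field_simp; norm_num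
    · intro xr x
      obtain ⟨p, hp, hpv, hα⟩ := exists_gradient_error hL₁ hL₂ (by linarith : 1 ≤ Cm) hν0 hgrad xr x
        (b := ⌈Dg / ‖x - xr‖ ^ 2⌉₊) (by rw [hDg])
      obtain ⟨q, hq, hqU, hβ⟩ := exists_hessian_error (θ := κ * ν) (b := ⌈Dh⌉₊) hf hL₂
        (by linarith : 1 ≤ Cm) hCh hn0 (by positivity) (by rw [mul_pow, hκ3, hν3]) hhess hd xr x
        (by rw [← hDh]; exact Nat.le_ceil _)
      refine ⟨p, q, _, _, hp, hq, hpv, hqU, hα, hβ, ?_⟩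
      rw [hν3]
      have h1 : 16 / Cm ≤ 1 / 4608 := by rw [div_le_div_iff₀ hC0 (by norm_num)]; linarith
      have h2 : 578000 / (Cm * Ch) ≤ 1 / 4608 := by
        rw [div_le_iff₀ hCh] at hCm2
        rw [div_le_div_iff₀ (by positivity) (by norm_num)]; linarith
      have h3 : 0 ≤ Cm * L₂ * ‖x - xr‖ ^ 3 / n := by positivity
      have e1 : Cm * L₂ * (8 * (2 * ‖x - xr‖ ^ 3 / (Cm * n))
          + 289 * (2000 * ‖x - xr‖ ^ 3 / (Cm * Ch * n)))
          = Cm * L₂ * ‖x - xr‖ ^ 3 / n * (16 / Cm + 578000 / (Cm * Ch)) := by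
        field_simp
        ring
      rw [e1]
      calc Cm * L₂ * ‖x - xr‖ ^ 3 / n * (16 / Cm + 578000 / (Cm * Ch))
          ≤ Cm * L₂ * ‖x - xr‖ ^ 3 / n * (1 / 4608 + 1 / 4608) := by gcongr
        _ = _ := by ring
  have hS0 : 0 < S := by omega
  have hS0' : (0 : ℝ) < S := by exact_mod_cast hS0
  have hε3 : ε ^ (3 / 2 : ℝ) = √ε ^ 3 := rpow_three_halves hε.le
  have hse : 0 < √ε := Real.sqrt_pos.mpr hε
  have hsC : 0 < √Cm := Real.sqrt_pos.mpr hC0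
  have hsL : 0 < √L₂ := Real.sqrt_pos.mpr hL₂
  rw [hε3] at hS ⊢
  set A : ℝ := 6144 * Cm ^ 2 * (√L₂ * gap f x₀) / (√ε ^ 3 * ν) with hA
  have hA0 : 0 ≤ A := by positivity
  refine ⟨?_, fun x hx => isApproxLocalMin_of_mu_le (by linarith) hL₂ hε hx, ?_⟩
  · refine (expect_liteSVRC_le hM hlb hS0 hT0 x₀ hepoch).trans (ENNReal.ofReal_le_ofReal ?_)
    change 3072 * √(Cm * L₂) / (S * T) * gap f x₀ ≤ _
    have hAS : A ≤ S := by
      rw [hS]; push_cast; exact (Nat.lt_floor_add_one A).le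
    rw [rpow_three_halves (by positivity), Real.sqrt_div hε.le, Real.sqrt_mul hC0.le,
      div_mul_eq_mul_div, div_le_iff₀ (by positivity)]
    have hCsq : Cm ^ 2 = √Cm ^ 4 := by
      rw [show √Cm ^ 4 = (√Cm ^ 2) ^ 2 by ring, Real.sq_sqrt hC0.le]
    calc 3072 * (√Cm * √L₂) * gap f x₀ = (√ε / √Cm) ^ 3 * (A * (ν / 2)) := by
          rw [hA, hCsq]; field_simp; ring
      _ ≤ (√ε / √Cm) ^ 3 * (S * T) := by gcongr; linarith
  · intro o ho
    rw [support_liteSVRC hT0 o ho]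
    have hT1' : ((T - 1 : ℕ) : ℝ) ≤ ν := by
      rw [Nat.cast_sub hT0]; push_cast; linarith
    -- Rounding up costs at most a factor `2`, since `D_h > 25 log d > 1`.
    have hceil : (⌈Dh⌉₊ : ℝ) ≤ 2 * Dh := by
      have := Nat.ceil_lt_add_one (show 0 ≤ Dh by linarith)
      linarith
    have hper : (n : ℝ) + (T - 1 : ℕ) * (2 * ⌈Dh⌉₊) ≤ (2 + 4 * κ ^ 2) * Real.log d * n := by
      have h1 : ((T - 1 : ℕ) : ℝ) * (2 * ⌈Dh⌉₊) ≤ ν * (2 * (2 * Dh)) := by gcongr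
      have h2 : ν * (2 * (2 * Dh)) = 4 * κ ^ 2 * Real.log d * n := by rw [hDh, ← hν3]; ring
      have h3 : (n : ℝ) ≤ 2 * Real.log d * n :=
        le_mul_of_one_le_left hn0.le (by linarith)
      linarith
    have hSle : (S : ℝ) ≤ A + 1 := by
      rw [hS]; push_cast
      have := Nat.floor_le hA0
      linarith
    push_cast
    have h1C : (1 : ℝ) ≤ 6144 * Cm ^ 2 := by
      have : 1 ≤ Cm ^ 2 := one_le_pow₀ (by linarith)
      linarith
    calc (S : ℝ) * (n + (T - 1 : ℕ) * (2 * ⌈Dh⌉₊))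
        ≤ (A + 1) * ((2 + 4 * κ ^ 2) * Real.log d * n) := by gcongr
      _ = (2 + 4 * κ ^ 2) * Real.log d * (1 * n + A * n) := by ring
      _ ≤ (2 + 4 * κ ^ 2) * Real.log d * (6144 * Cm ^ 2 * n + A * n) := by gcongr
      _ = _ := by rw [hA, ← hν3]; field_simp
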